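/- On $M=\mathbb R\times\mathbb T^2$, where $\mathbb T^2=\mathbb S^1\times\mathbb S^1$, with coordinates $(r,x,y)$ ($x,y$ being $2\pi$-periodic), there exist a smooth Riemannian metric $g$ and a smooth function $f:M\to\mathbb R$ of the form $$g=dr^2+e^{2h(r)}(dx^2+dy^2),\qquad f=f(r),$$ with $h,f:\mathbb R\to\mathbb R$ smooth, such that $(M,g,f)$ is an expanding gradient Ricci soliton, $$\mathrm{Ric}+\mathrm{Hess}\, f+\tfrac12 g=0,$$ and the following hold. 1. All sectional curvatures satisfy $-\frac14<\sec<0$. 2. At the end $r\to-\infty$ the soliton approaches the hyperbolic cusp expanding soliton (a metric $dr^2+e^{r+2c}(dx^2+dy^2)$ of constant curvature $-\frac14$, with constant potential). Precisely, as $r\to-\infty$: $h\sim\frac r2$; $h-\frac r2$ converges; $h'\to\frac12$; $h''\to0$; $f$ converges to a constant; $f'\to0$; $f''\to0$; and $\sec\to-\frac14$ uniformly over the tori and over all tangent planes. 3. At the end $r\to+\infty$ the soliton approaches locally the flat Gaussian expanding soliton on a cone $dr^2+e^{2c}r^2(dx^2+dy^2)$. Precisely, as $r\to+\infty$: $h\sim\ln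 r$; $h-\ln r$ converges; $h'\sim\frac1r$; $h''\to0$; $f\sim-\frac{r^2}4$; $f'\sim-\frac r2$; $f''\to-\frac12$; and $\sec\to0$ uniformly over the tori and over all tangent planes. 4. The curve $(H,F)=(h',f')$ is a separatrix of the planar system $$H'=HF-2H^2+\tfrac12,\qquad F'=2HF-2H^2+\tfrac12$$ emanating from the saddle point $(\frac12,0)$: it is a nonconstant solution defined for all $r\in\mathbb R$ that tends to $(\frac12,0)$ as $r\to-\infty$. As $r\to+\infty$, $H\to0$ and $F\to-\infty$. Here $\phi\sim\psi$ means $\phi/\psi\to1$. -/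

import Mathlib

open Filter Topology Manifold ContDiff

noncomputable section

namespace Soliton

/-! ### Riemannian geometry in coordinates

`G` is the matrix field `G u i j = g(∂ᵢ, ∂ⱼ)` of a Riemannian metric in coordinates
`u = (u₁, …, uₙ)`. -/

/-- The partial derivative `∂ᵢ F (u)`. -/
def partialDeriv {n : ℕ} (i : Fin n) (F : (Fin n → ℝ) → ℝ) (u : Fin n → ℝ) : ℝ :=
  fderiv ℝ F u (Pi.single i 1)

/-- The Christoffel symbol `Γᵏᵢⱼ = ½ ∑ₗ gᵏˡ (∂ᵢ gⱼₗ + ∂ⱼ gᵢₗ - ∂ₗ gᵢⱼ)` of the Levi-Civita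
connection. -/
def christoffel {n : ℕ} (G : (Fin n → ℝ) → Matrix (Fin n) (Fin n) ℝ) (k i j : Fin n)
    (u : Fin n → ℝ) : ℝ :=
  (1 / 2) * ∑ l, (G u)⁻¹ k l *
    (partialDeriv i (fun w => G w j l) u + partialDeriv j (fun w => G w i l) u
      - partialDeriv l (fun w => G w i j) u)

/-- The component `Rˡₖᵢⱼ` of the curvature tensor, with `R(∂ᵢ, ∂ⱼ)∂ₖ = ∑ₗ Rˡₖᵢⱼ ∂ₗ` and
`R(X, Y)Z = ∇_X ∇_Y Z - ∇_Y ∇_X Z - ∇_[X,Y] Z`. -/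
def riemann {n : ℕ} (G : (Fin n → ℝ) → Matrix (Fin n) (Fin n) ℝ) (l k i j : Fin n)
    (u : Fin n → ℝ) : ℝ :=
  partialDeriv i (christoffel G l j k) u - partialDeriv j (christoffel G l i k) u
    + ∑ m, (christoffel G l i m u * christoffel G m j k u
      - christoffel G l j m u * christoffel G m i k u)

/-- The Ricci tensor `Ric(∂ⱼ, ∂ₖ)`, the trace of `X ↦ R(X, ∂ⱼ)∂ₖ`. -/
def ricci {n : ℕ} (G : (Fin n → ℝ) → Matrix (Fin n) (Fin n) ℝ) (j k : Fin n)
    (u : Fin n → ℝ) : ℝ :=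
  ∑ i, riemann G i k i j u

/-- The Hessian `Hess f (∂ᵢ, ∂ⱼ) = ∂ᵢ ∂ⱼ f - ∑ₖ Γᵏᵢⱼ ∂ₖ f`. -/
def hessian {n : ℕ} (G : (Fin n → ℝ) → Matrix (Fin n) (Fin n) ℝ) (f : (Fin n → ℝ) → ℝ)
    (i j : Fin n) (u : Fin n → ℝ) : ℝ :=
  partialDeriv i (partialDeriv j f) u - ∑ k, christoffel G k i j u * partialDeriv k f u

/-- The inner product `g(a, b)` of two coordinate vectors at `u`. -/
def innerAt {n : ℕ} (G : (Fin n → ℝ) → Matrix (Fin n) (Fin n) ℝ) (u a b : Fin n → ℝ) : ℝ :=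
  ∑ i, ∑ j, G u i j * a i * b j

/-- The sectional curvature
`sec(a, b) = g(R(a, b)b, a) / (g(a, a) g(b, b) - g(a, b)²)` of the plane spanned by `a`, `b`. -/
def sectional {n : ℕ} (G : (Fin n → ℝ) → Matrix (Fin n) (Fin n) ℝ) (u a b : Fin n → ℝ) : ℝ :=
  innerAt G u (fun l => ∑ k, ∑ i, ∑ j, riemann G l k i j u * a i * b j * b k) a /
    (innerAt G u a a * innerAt G u b b - innerAt G u a b ^ 2)

/-! ### Riemannian manifolds

The tensors of a Riemannian manifold at a point are computed in smooth coordinates around that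
point.  All conditions below are tensorial, so it does not matter in which coordinates. -/

section Manifold

variable {E : Type*} [NormedAddCommGroup E] [NormedSpace ℝ E]
  {H : Type*} [TopologicalSpace H] {I : ModelWithCorners ℝ E H}
  {M : Type*} [TopologicalSpace M] [ChartedSpace H M] [IsManifold I ∞ M]

/-- The matrix `g(∂ᵢ, ∂ⱼ)` of the metric `g` in the coordinates given by the parametrization `φ`,
that is, the matrix of the pulled back metric `φ^* g`. -/
def gram {n : ℕ} (g : Bundle.ContMDiffRiemannianMetric I ∞ E (TangentSpace I : M → Type _))
    (φ : (Fin n → ℝ) → M) (u : Fin n → ℝ) : Matrix (Fin n) (Fin n) ℝ :=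
  Matrix.of fun i j =>
    g.inner (φ u) (mfderiv 𝓘(ℝ, Fin n → ℝ) I φ u (Pi.single i 1 : Fin n → ℝ))
      (mfderiv 𝓘(ℝ, Fin n → ℝ) I φ u (Pi.single j 1 : Fin n → ℝ))

variable (I) in
/-- `φ` is a smooth parametrization (the inverse of a coordinate system) of a neighbourhood of `p`,
and `u` are the coordinates of `p`. -/
def IsCoordinatesAt {n : ℕ} (φ : (Fin n → ℝ) → M) (u : Fin n → ℝ) (p : M) : Prop :=
  IsLocalDiffeomorphAt 𝓘(ℝ, Fin n → ℝ) I ∞ φ u ∧ φ u = p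

/-- `(M, g, f)` is a gradient Ricci soliton with constant `ε`: the function `f` is smooth and
`Ric + Hess f + (ε / 2) g = 0`.  It is expanding if `ε = 1`. -/
def IsGradientRicciSoliton
    (g : Bundle.ContMDiffRiemannianMetric I ∞ E (TangentSpace I : M → Type _))
    (f : M → ℝ) (ε : ℝ) : Prop :=
  ContMDiff I 𝓘(ℝ, ℝ) ∞ f ∧
  ∀ p : M, ∃ (n : ℕ) (φ : (Fin n → ℝ) → M) (u : Fin n → ℝ),
    IsCoordinatesAt I φ u p ∧
    ∀ i j, ricci (gram g φ) i j u + hessian (gram g φ) (f ∘ φ) i j u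
      + ε / 2 * gram g φ u i j = 0

/-- The sectional curvatures of all tangent planes at `p` lie in the set `S`. -/
def SectionalCurvatureMem
    (g : Bundle.ContMDiffRiemannianMetric I ∞ E (TangentSpace I : M → Type _))
    (p : M) (S : Set ℝ) : Prop :=
  ∃ (n : ℕ) (φ : (Fin n → ℝ) → M) (u : Fin n → ℝ),
    IsCoordinatesAt I φ u p ∧
    ∀ a b : Fin n → ℝ, LinearIndependent ℝ ![a, b] →
      sectional (gram g φ) u a b ∈ S

end Manifold

/-! ### The manifold `ℝ × T²` -/

/-- The product of the real line and the two-torus. -/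
abbrev LineTorus : Type := ℝ × Circle × Circle

/-- The model with corners of the smooth manifold `ℝ × T²`. -/
abbrev lineTorusModel :=
  (𝓘(ℝ, ℝ)).prod ((𝓡 1).prod (𝓡 1))

/-- The coordinates `(r, x, y)` on `ℝ × T²`, with `x` and `y` periodic: the covering map
`(r, x, y) ↦ (r, e^{ix}, e^{iy})`. -/
def torusCoord (u : Fin 3 → ℝ) : LineTorus := (u 0, Circle.exp (u 1), Circle.exp (u 2))

/-- Smooth Riemannian metrics on `ℝ × T²`. -/
abbrev LineTorusMetric : Type :=
  Bundle.ContMDiffRiemannianMetric lineTorusModel ∞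
    (ℝ × EuclideanSpace ℝ (Fin 1) × EuclideanSpace ℝ (Fin 1))
    (TangentSpace lineTorusModel : LineTorus → Type)

/-- `g = dr² + e^{2h(r)} (dx² + dy²)`. -/
def IsWarpedMetric (g : LineTorusMetric) (h : ℝ → ℝ) : Prop :=
  ∀ u : Fin 3 → ℝ, gram g torusCoord u =
    Matrix.diagonal ![1, Real.exp (2 * h (u 0)), Real.exp (2 * h (u 0))]

/-- The sectional curvatures at `(r, z, w)` converge to `κ` as `r` tends to the given end,
uniformly on the tori and over all tangent planes. -/
def SectionalCurvatureTendsto (g : LineTorusMetric) (l : Filter ℝ) (κ : ℝ) : Prop :=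
  ∀ δ > 0, ∀ᶠ r in l, ∀ z w : Circle,
    SectionalCurvatureMem g ((r, z, w) : LineTorus) (Set.Ioo (κ - δ) (κ + δ))

/-! ### Planar dynamics -/

/-- The vector field of the system `H' = HF - 2H² + 1/2`, `F' = 2HF - 2H² + 1/2`. -/
def solitonField (z : ℝ × ℝ) : ℝ × ℝ :=
  (z.1 * z.2 - 2 * z.1 ^ 2 + 1 / 2, 2 * z.1 * z.2 - 2 * z.1 ^ 2 + 1 / 2)

/-- `z` is a (hyperbolic) saddle point of the planar vector field `V`. -/
def IsSaddlePoint (V : ℝ × ℝ → ℝ × ℝ) (z : ℝ × ℝ) : Prop :=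
  V z = 0 ∧ DifferentiableAt ℝ V z ∧ ∃ μ ν : ℝ, μ < 0 ∧ 0 < ν ∧
    Module.End.HasEigenvalue (fderiv ℝ V z : ℝ × ℝ →ₗ[ℝ] ℝ × ℝ) μ ∧
    Module.End.HasEigenvalue (fderiv ℝ V z : ℝ × ℝ →ₗ[ℝ] ℝ × ℝ) ν

/-- `γ` is a separatrix of the planar vector field `V` emanating from the saddle point `z`:
a nonconstant trajectory, defined for all times, that tends to `z` at time `-∞`. -/
def IsSeparatrixFrom (V : ℝ × ℝ → ℝ × ℝ) (z : ℝ × ℝ) (γ : ℝ → ℝ × ℝ) : Prop :=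
  IsSaddlePoint V z ∧ (∀ r, HasDerivAt γ (V (γ r)) r) ∧ (∃ r, γ r ≠ z) ∧
    Tendsto γ atBot (𝓝 z)

end Soliton

end

/-! For a warped metric with radial potential, the soliton equation reduces to two scalar equations:
the radial component gives `f'' = 2(h'' + h'²) - 1/2` and the torus components give `h'' = h'f' -
2h'² + 1/2`. Together they are the planar system for `(H, F) = (h', f')`. So it suffices to find one
good trajectory, integrate it to `h` and `f`, and build the metric. The sectional curvature of any
plane is a convex combination of `-(h'' + h'²)` and `-h'²`, so curvature bounds and limits also
become statements about `(H, F)`.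

The linearization at `(1/2, 0)` has characteristic polynomial `μ² + μ - 1`, with positive root `λ =
(√5 - 1)/2`. Its unstable manifold is written as a convergent power series in `s = e^{λr}`;
quadratic forcing gives an explicit recursion, and a uniform bound on the coefficients gives a
solution for `r < 0` (`unstableCoeff`, `shiftedSeries_ode`, `abs_unstableCoeff_le`). Exponential
closeness to the saddle makes `h - r/2` and `f` converge at the cusp end.

The chosen branch starts in the region `IsPinched`, which is forward invariant because each defining
quantity satisfies a linear equation with nonnegative forcing (`isPinched_of_hasDerivAt`). The
region bounds `H` and keeps `F` from falling faster than linearly, so the trajectory is global. It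
also forces `H` to decrease, `F` to go to `-∞` linearly, and `H²- 1/2 < HF < 2H² - 1/2`. Hence `H →
0` and `HF → -1/2`, and `F + r/2` and `h - ln r` have integrable derivatives
(`pinched_asymptotics`). -/

section
-- Smoothness of pulled back bilinear forms.
variable {E : Type*} [NormedAddCommGroup E] [NormedSpace ℝ E]
  {H : Type*} [TopologicalSpace H] {I : ModelWithCorners ℝ E H}
  {M : Type*} [TopologicalSpace M] [ChartedSpace H M]
  {V : Type*} [NormedAddCommGroup V] [NormedSpace ℝ V]
  {W : Type*} [NormedAddCommGroup W] [NormedSpace ℝ W]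

/-- The derivative of a map into a vector space, as a linear map on the model space. -/
noncomputable def modelDeriv (I : ModelWithCorners ℝ E H) (J : M → V) (p : M) : E →L[ℝ] V :=
  mfderiv I 𝓘(ℝ, V) J p

/-- The pullback of a bilinear form by a linear map. -/
noncomputable def pullbackForm (B : V →L[ℝ] V →L[ℝ] ℝ) (A : E →L[ℝ] V) : E →L[ℝ] E →L[ℝ] ℝ :=
  B.bilinearComp A A

/-- The pullback to the tangent spaces of `M` of a family of bilinear forms by the derivative
of a map into a vector space. -/
noncomputable def pullbackTensor (I : ModelWithCorners ℝ E H) (J : M → V)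
    (B : M → V →L[ℝ] V →L[ℝ] ℝ) (p : M) : TangentSpace I p →L[ℝ] TangentSpace I p →L[ℝ] ℝ :=
  pullbackForm (E := E) (B p) (modelDeriv I J p)

theorem ContMDiffAt.pullbackForm {x₀ : M} {B : M → V →L[ℝ] V →L[ℝ] ℝ}
    (hB : ContMDiffAt I 𝓘(ℝ, V →L[ℝ] V →L[ℝ] ℝ) ∞ B x₀) {A : M → W →L[ℝ] V}
    (hA : ContMDiffAt I 𝓘(ℝ, W →L[ℝ] V) ∞ A x₀) :
    ContMDiffAt I 𝓘(ℝ, W →L[ℝ] W →L[ℝ] ℝ) ∞ (fun x => pullbackForm (B x) (A x)) x₀ := by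
  exact ((hA.clm_precomp (F₃ := ℝ)).clm_comp hB).clm_comp hA

variable [IsManifold I ∞ M]

/-- The target of `J` is a vector space, so only the source needs trivializing: near `x₀` the tensor
in coordinates is `B` composed twice with the coordinate expression of `dJ`, which is smooth. -/
theorem contMDiff_pullbackForm {J : M → V} (hJ : ContMDiff I 𝓘(ℝ, V) ∞ J)
    {B : M → V →L[ℝ] V →L[ℝ] ℝ} (hB : ContMDiff I 𝓘(ℝ, V →L[ℝ] V →L[ℝ] ℝ) ∞ B) :
    ContMDiff I (I.prod 𝓘(ℝ, E →L[ℝ] E →L[ℝ] ℝ)) ∞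
      (fun p => Bundle.TotalSpace.mk' (E →L[ℝ] E →L[ℝ] ℝ)
          (E := (fun p : M => TangentSpace I p →L[ℝ] TangentSpace I p →L[ℝ] ℝ)) p
          (pullbackTensor I J B p)) := by
  intro x₀
  rw [contMDiffAt_hom_bundle]
  refine ⟨contMDiffAt_id, ?_⟩
  have hA : ContMDiffAt I 𝓘(ℝ, E →L[ℝ] V) ∞
      (inTangentCoordinates I 𝓘(ℝ, V) id J (mfderiv I 𝓘(ℝ, V) J) x₀) x₀ :=
    (hJ x₀).mfderiv_const le_rfl
  refine ((hB x₀).pullbackForm hA).congr_of_eventuallyEq ?_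
  filter_upwards [(trivializationAt E (TangentSpace I) x₀).open_baseSet.mem_nhds
    (FiberBundle.mem_baseSet_trivializationAt E (TangentSpace I) x₀)] with x hx
  ext v w
  refine (inCoordinates_apply_eq₂ hx hx (by simp)).trans ?_
  have h : ∀ v : E, inTangentCoordinates I 𝓘(ℝ, V) id J (mfderiv I 𝓘(ℝ, V) J) x₀ x v =
      modelDeriv I J x ((trivializationAt E (TangentSpace I) x₀).symm x v) := by
    intro v
    simp [inTangentCoordinates, ContinuousLinearMap.inCoordinates, modelDeriv]
    change (1 : V →L[ℝ] V) (mfderiv I 𝓘(ℝ, V) J x (Bundle.Trivialization.symmL ℝ (trivializationAt E (TangentSpace I) x₀) x v)) = _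
    rw [Bundle.Trivialization.symmL_apply _ hx]
    rfl
  simp only [pullbackForm, ContinuousLinearMap.bilinearComp_apply, h]
  simp
  rfl
end

/-! ### The warped metric on the line times the torus, induced from `ℝ × ℂ × ℂ`. -/

noncomputable section

/-- By compactness the form has a positive minimum `m` on the unit sphere, so `Q v v ≥ m‖v‖²` by
homogeneity and the unit ball of `Q` is bounded in norm. -/
theorem isVonNBounded_of_posDef {E : Type*} [NormedAddCommGroup E] [NormedSpace ℝ E]
    [FiniteDimensional ℝ E] (Q : E →L[ℝ] E →L[ℝ] ℝ) (hQ : ∀ v, v ≠ 0 → 0 < Q v v) :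
    Bornology.IsVonNBounded ℝ {v : E | Q v v < 1} := by
  rcases subsingleton_or_nontrivial E with hE | hE
  · exact (NormedSpace.isVonNBounded_iff ℝ).2 (Set.toFinite _).isBounded
  have hcont : Continuous fun v : E => Q v v := by fun_prop
  obtain ⟨v₀, hv₀, hmin⟩ := (isCompact_sphere (0 : E) 1).exists_isMinOn
    (NormedSpace.sphere_nonempty.2 zero_le_one) hcont.continuousOn
  have hv₀1 : ‖v₀‖ = 1 := by simpa using hv₀
  have hm : 0 < Q v₀ v₀ := hQ v₀ (by rintro rfl; simp at hv₀1)
  have hle : ∀ v, Q v₀ v₀ * ‖v‖ ^ 2 ≤ Q v v := by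
    intro v
    rcases eq_or_ne v 0 with rfl | hv
    · simp
    have hn : 0 < ‖v‖ := norm_pos_iff.2 hv
    have h := hmin (show ‖v‖⁻¹ • v ∈ Metric.sphere (0 : E) 1 by
      simp [norm_smul, hn.ne'])
    simp only [Set.mem_ofPred_eq, map_smul, smul_apply, smul_eq_mul] at h
    calc Q v₀ v₀ * ‖v‖ ^ 2 ≤ (‖v‖⁻¹ * (‖v‖⁻¹ * Q v v)) * ‖v‖ ^ 2 := by gcongr
      _ = Q v v := by field_simp
  rw [NormedSpace.isVonNBounded_iff, isBounded_iff_forall_norm_le]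
  refine ⟨1 + 1 / Q v₀ v₀, fun v hv => ?_⟩
  have h1 : Q v₀ v₀ * ‖v‖ ^ 2 < 1 := (hle v).trans_lt hv
  have h2 : ‖v‖ ^ 2 ≤ 1 / Q v₀ v₀ := by
    rw [le_div_iff₀ hm]; linarith
  -- Uses `‖v‖ ≤ ‖v‖² + 1/4`.
  nlinarith [sq_nonneg (‖v‖ - 1 / 2)]

namespace Soliton

/-- The standard embedding of `ℝ × T²` in `ℝ × ℂ × ℂ`. -/
def lineTorusEmbedding (p : LineTorus) : ℝ × ℂ × ℂ := (p.1, (p.2.1 : ℂ), (p.2.2 : ℂ))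

/-- The inclusion of the circle in the complex plane. -/
def circleVal (z : Circle) : ℂ := z

theorem contMDiff_circleVal : ContMDiff (𝓡 1) 𝓘(ℝ, ℂ) ∞ circleVal :=
  haveI : Fact (Module.finrank ℝ ℂ = 1 + 1) := finrank_real_complex_fact'
  contMDiff_coe_sphere

theorem contMDiff_lineTorusEmbedding :
    ContMDiff lineTorusModel 𝓘(ℝ, ℝ × ℂ × ℂ) ∞ lineTorusEmbedding :=
  contMDiff_fst.prodMk_space ((contMDiff_circleVal.comp (contMDiff_fst.comp contMDiff_snd)).prodMk_space
    (contMDiff_circleVal.comp (contMDiff_snd.comp contMDiff_snd)))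

theorem modelDeriv_lineTorusEmbedding (p : LineTorus)
    (v : ℝ × EuclideanSpace ℝ (Fin 1) × EuclideanSpace ℝ (Fin 1)) :
    modelDeriv lineTorusModel lineTorusEmbedding p v =
      (v.1, modelDeriv (𝓡 1) circleVal p.2.1 v.2.1,
        modelDeriv (𝓡 1) circleVal p.2.2 v.2.2) := by
  have hc : ∀ z : Circle, HasMFDerivAt (𝓡 1) 𝓘(ℝ, ℂ) circleVal z
    (mfderiv (𝓡 1) 𝓘(ℝ, ℂ) circleVal z) := fun z =>
    ((contMDiff_circleVal z).mdifferentiableAt (by simp)).hasMFDerivAt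
  have h1 := (hasMFDerivAt_fst (I := 𝓘(ℝ, ℝ)) (I' := (𝓡 1).prod (𝓡 1)) (x := p))
  have h2 := (hc p.2.1).comp p ((hasMFDerivAt_fst (I := 𝓡 1) (I' := 𝓡 1) (x := p.2)).comp p
    (hasMFDerivAt_snd (I := 𝓘(ℝ, ℝ)) (I' := (𝓡 1).prod (𝓡 1)) (x := p)))
  have h3 := (hc p.2.2).comp p ((hasMFDerivAt_snd (I := 𝓡 1) (I' := 𝓡 1) (x := p.2)).comp p
    (hasMFDerivAt_snd (I := 𝓘(ℝ, ℝ)) (I' := (𝓡 1).prod (𝓡 1)) (x := p)))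
  have h : HasMFDerivAt lineTorusModel 𝓘(ℝ, ℝ × ℂ × ℂ) lineTorusEmbedding p _ :=
    ⟨h1.1.prodMk (h2.1.prodMk h3.1), h1.2.prodMk (h2.2.prodMk h3.2)⟩
  unfold modelDeriv
  exact congrArg (fun L : (ℝ × EuclideanSpace ℝ (Fin 1) × EuclideanSpace ℝ (Fin 1)) →L[ℝ] ℝ × ℂ × ℂ => L v) h.mfderiv

/-- The bilinear form `dr² + e^{2t} (|dz|² + |dw|²)` on `ℝ × ℂ × ℂ`. -/
def warpedForm (t : ℝ) : (ℝ × ℂ × ℂ) →L[ℝ] (ℝ × ℂ × ℂ) →L[ℝ] ℝ :=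
  pullbackForm (innerSL ℝ) (ContinuousLinearMap.fst ℝ ℝ (ℂ × ℂ)) +
    Real.exp (2 * t) •
      (pullbackForm (innerSL ℝ) ((ContinuousLinearMap.fst ℝ ℂ ℂ).comp (ContinuousLinearMap.snd ℝ ℝ (ℂ × ℂ))) +
       pullbackForm (innerSL ℝ) ((ContinuousLinearMap.snd ℝ ℂ ℂ).comp (ContinuousLinearMap.snd ℝ ℝ (ℂ × ℂ))))

theorem warpedForm_apply (t : ℝ) (v w : ℝ × ℂ × ℂ) :
    warpedForm t v w = v.1 * w.1 +
      Real.exp (2 * t) * (inner ℝ v.2.1 w.2.1 + inner ℝ v.2.2 w.2.2) := by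
  change inner ℝ v.1 w.1 +
    Real.exp (2 * t) * (inner ℝ v.2.1 w.2.1 + inner ℝ v.2.2 w.2.2) = _
  rw [Real.inner_apply]

theorem warpedForm_self_pos (t : ℝ) {v : ℝ × ℂ × ℂ} (hv : v ≠ 0) : 0 < warpedForm t v v := by
  rw [warpedForm_apply, real_inner_self_eq_norm_sq, real_inner_self_eq_norm_sq]
  by_contra! h
  have h0 := Real.exp_pos (2 * t)
  have h1 : v.1 = 0 := by
    by_contra h'
    have : 0 < v.1 * v.1 := mul_self_pos.2 h'
    have : 0 ≤ Real.exp (2 * t) * (‖v.2.1‖ ^ 2 + ‖v.2.2‖ ^ 2) := by positivity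
    linarith
  have h2 : ‖v.2.1‖ ^ 2 + ‖v.2.2‖ ^ 2 ≤ 0 := by
    by_contra! h'
    have := mul_pos h0 h'
    simp [h1] at h
    linarith
  have h3 : ‖v.2.1‖ = 0 := by nlinarith [sq_nonneg ‖v.2.1‖, sq_nonneg ‖v.2.2‖]
  have h4 : ‖v.2.2‖ = 0 := by nlinarith [sq_nonneg ‖v.2.1‖, sq_nonneg ‖v.2.2‖]
  exact hv (Prod.ext h1 (Prod.ext (norm_eq_zero.1 h3) (norm_eq_zero.1 h4)))

theorem modelDeriv_lineTorusEmbedding_ne_zero (p : LineTorus)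
    {v : ℝ × EuclideanSpace ℝ (Fin 1) × EuclideanSpace ℝ (Fin 1)} (hv : v ≠ 0) :
    modelDeriv lineTorusModel lineTorusEmbedding p v ≠ 0 := by
  intro h
  have hinj : ∀ z : Circle, Function.Injective (modelDeriv (𝓡 1) circleVal z) :=
    fun z => by
    have : Fact (Module.finrank ℝ ℂ = 1 + 1) := finrank_real_complex_fact'
    exact injective_mvfderiv_subtypeVal_sphere (n := 1) z
  rw [modelDeriv_lineTorusEmbedding] at h
  simp only [Prod.mk_eq_zero] at h
  exact hv (Prod.ext h.1 (Prod.ext (hinj _ (h.2.1.trans (map_zero _).symm))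
    (hinj _ (h.2.2.trans (map_zero _).symm))))

/-- The warped product metric `dr² + e^{2h(r)} (dx² + dy²)`. -/
def warpedMetric (h : ℝ → ℝ) (hh : ContDiff ℝ ∞ h) : LineTorusMetric where
  inner p := pullbackTensor lineTorusModel lineTorusEmbedding (fun p => warpedForm (h p.1)) p
  symm p v w := by
    change warpedForm _ _ _ = warpedForm _ _ _
    simp only [warpedForm_apply, real_inner_comm, mul_comm]
  pos p v hv := warpedForm_self_pos _ (modelDeriv_lineTorusEmbedding_ne_zero p hv)
  isVonNBounded p := isVonNBounded_of_posDef
    (E := ℝ × EuclideanSpace ℝ (Fin 1) × EuclideanSpace ℝ (Fin 1)) _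
    fun v hv => warpedForm_self_pos _ (modelDeriv_lineTorusEmbedding_ne_zero p hv)
  contMDiff := by
    refine contMDiff_pullbackForm contMDiff_lineTorusEmbedding ?_
    have h1 : ContDiff ℝ ∞ fun r => warpedForm (h r) := by
      have h2 : ContDiff ℝ ∞ fun r => Real.exp (2 * h r) :=
        Real.contDiff_exp.comp (contDiff_const.mul hh)
      refine contDiff_clm_apply_iff.2 fun v => contDiff_clm_apply_iff.2 fun w => ?_
      simp only [warpedForm_apply]
      exact contDiff_const.add (h2.mul contDiff_const)
    exact h1.contMDiff.comp contMDiff_fst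

end Soliton

end

/-! ### Angular coordinates and the Gram matrix of the warped metric. -/

noncomputable section

namespace Soliton

theorem contMDiff_torusCoord :
    ContMDiff 𝓘(ℝ, Fin 3 → ℝ) lineTorusModel ∞ torusCoord := by
  have hpr : ∀ i : Fin 3, ContMDiff 𝓘(ℝ, Fin 3 → ℝ) 𝓘(ℝ, ℝ) ∞ (fun u : Fin 3 → ℝ => u i) :=
    fun i => (contDiff_apply ℝ ℝ i).contMDiff
  exact (hpr 0).prodMk ((contMDiff_circleExp.comp (hpr 1)).prodMk
    (contMDiff_circleExp.comp (hpr 2)))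

theorem hasFDerivAt_lineTorusEmbedding_torusCoord (u : Fin 3 → ℝ) :
    HasFDerivAt (lineTorusEmbedding ∘ torusCoord)
      ((ContinuousLinearMap.proj (R := ℝ) (φ := fun _ : Fin 3 => ℝ) 0).prod
        (((ContinuousLinearMap.proj (R := ℝ) (φ := fun _ : Fin 3 => ℝ) 1).smulRight
            (Complex.exp (u 1 * Complex.I) * Complex.I)).prod
          ((ContinuousLinearMap.proj (R := ℝ) (φ := fun _ : Fin 3 => ℝ) 2).smulRight
            (Complex.exp (u 2 * Complex.I) * Complex.I)))) u := by
  have hpr : ∀ i : Fin 3, HasFDerivAt (fun u : Fin 3 → ℝ => u i)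
      (ContinuousLinearMap.proj (R := ℝ) (φ := fun _ : Fin 3 => ℝ) i) u :=
    fun i => hasFDerivAt_apply i u
  have hexp : ∀ t : ℝ, HasDerivAt (fun t : ℝ => (Circle.exp t : ℂ))
      (Complex.exp (t * Complex.I) * Complex.I) t := by
    intro t
    have h1 : HasDerivAt (fun t : ℝ => (t : ℂ) * Complex.I) Complex.I t := by
      simpa using (Complex.ofRealCLM.hasDerivAt (x := t)).mul_const Complex.I
    simpa [Circle.coe_exp] using h1.cexp
  have hcomp : ∀ i : Fin 3, HasFDerivAt (fun v : Fin 3 → ℝ => (Circle.exp (v i) : ℂ))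
      ((ContinuousLinearMap.proj (R := ℝ) (φ := fun _ : Fin 3 => ℝ) i).smulRight
        (Complex.exp (u i * Complex.I) * Complex.I)) u := by
    intro i
    have h1 := (hexp (u i)).hasFDerivAt
    exact HasFDerivAt.comp (g := fun t : ℝ => (Circle.exp t : ℂ)) u h1 (hpr i)
  exact (hpr 0).prodMk ((hcomp 1).prodMk (hcomp 2))

theorem modelDeriv_comp_mfderiv_torusCoord (u v : Fin 3 → ℝ) :
    modelDeriv lineTorusModel lineTorusEmbedding (torusCoord u)
      (mfderiv 𝓘(ℝ, Fin 3 → ℝ) lineTorusModel torusCoord u v) =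
    (v 0, v 1 • (Complex.exp (u 1 * Complex.I) * Complex.I),
      v 2 • (Complex.exp (u 2 * Complex.I) * Complex.I)) := by
  have h1 := ((contMDiff_lineTorusEmbedding (torusCoord u)).mdifferentiableAt (by simp)).hasMFDerivAt
  have h2 := ((contMDiff_torusCoord u).mdifferentiableAt (by simp)).hasMFDerivAt
  have h3 : HasFDerivAt (lineTorusEmbedding ∘ torusCoord)
      ((modelDeriv lineTorusModel lineTorusEmbedding (torusCoord u)).comp
        (show (Fin 3 → ℝ) →L[ℝ] ℝ × EuclideanSpace ℝ (Fin 1) × EuclideanSpace ℝ (Fin 1) from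
          mfderiv 𝓘(ℝ, Fin 3 → ℝ) lineTorusModel torusCoord u)) u :=
    (h1.comp u h2).hasFDerivAt
  exact congrArg (fun L : (Fin 3 → ℝ) →L[ℝ] ℝ × ℂ × ℂ => L v)
    (h3.unique (hasFDerivAt_lineTorusEmbedding_torusCoord u))

theorem isWarpedMetric_warpedMetric (h : ℝ → ℝ) (hh : ContDiff ℝ ∞ h) :
    IsWarpedMetric (warpedMetric h hh) h := by
  intro u
  -- The velocity `i e^{it}` of the circle has unit length.
  have hI : ∀ (t a b : ℝ), inner ℝ (a • (Complex.exp (t * Complex.I) * Complex.I))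
      (b • (Complex.exp (t * Complex.I) * Complex.I)) = a * b := by
    intro t a b
    rw [real_inner_smul_left, real_inner_smul_right, real_inner_self_eq_norm_sq]
    simp [Complex.norm_exp_ofReal_mul_I]
  ext i j
  refine (congrArg₂ (fun v w => warpedForm (h (u 0)) v w)
    (modelDeriv_comp_mfderiv_torusCoord u (Pi.single i 1))
    (modelDeriv_comp_mfderiv_torusCoord u (Pi.single j 1))).trans ?_
  rw [warpedForm_apply]
  simp only [hI]
  fin_cases i <;> fin_cases j <;> simp [Matrix.diagonal]

/-- A smooth inverse of `Circle.exp` near `t`. -/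
def circleLift (t : ℝ) (z : Circle) : ℝ := t + (Complex.log (z * Complex.exp (-t * Complex.I))).im

theorem circleLift_exp {t s : ℝ} (h : s ∈ Set.Ioo (t - Real.pi) (t + Real.pi)) :
    circleLift t (Circle.exp s) = s := by
  rw [circleLift, Circle.coe_exp, ← Complex.exp_add,
    show (s : ℂ) * Complex.I + -t * Complex.I = ((s - t : ℝ) : ℂ) * Complex.I by push_cast; ring,
    Complex.log_exp] <;> simp <;> linarith [h.1, h.2]

theorem exp_circleLift (t : ℝ) (z : Circle) : Circle.exp (circleLift t z) = z := by
  apply Subtype.ext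
  have h0 : (z : ℂ) * Complex.exp (-t * Complex.I) ≠ 0 := mul_ne_zero z.coe_ne_zero (Complex.exp_ne_zero _)
  have h1 : ‖(z : ℂ) * Complex.exp (-t * Complex.I)‖ = 1 := by
    rw [norm_mul, Circle.norm_coe, ← Complex.ofReal_neg, Complex.norm_exp_ofReal_mul_I, one_mul]
  have h2 : ((Complex.log (z * Complex.exp (-t * Complex.I))).im : ℂ) * Complex.I =
      Complex.log (z * Complex.exp (-t * Complex.I)) := by
    apply Complex.ext
    · simp only [Complex.log_re, h1, Real.log_one]
      simp
    · simp
  rw [Circle.coe_exp, circleLift, Complex.ofReal_add, add_mul, Complex.exp_add, h2, Complex.exp_log h0,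
    mul_left_comm, ← Complex.exp_add]
  simp

/-- The arc of the circle centred at `e^{it}` that omits the antipode. -/
def circleArc (t : ℝ) : Set Circle :=
  {z | (z : ℂ) * Complex.exp (-t * Complex.I) ∈ Complex.slitPlane}

theorem isOpen_circleArc (t : ℝ) : IsOpen (circleArc t) :=
  Complex.isOpen_slitPlane.preimage (by fun_prop)

theorem contMDiffOn_circleLift (t : ℝ) :
    ContMDiffOn (𝓡 1) 𝓘(ℝ, ℝ) ∞ (circleLift t) (circleArc t) := by
  intro z hz
  have h1 : ContDiffAt ℝ ∞ (fun w : ℂ => t + (Complex.log (w * Complex.exp (-t * Complex.I))).im) (circleVal z) := by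
    have h2 : ContDiffAt ℝ ∞ Complex.log ((fun w : ℂ => w * Complex.exp (-t * Complex.I)) (circleVal z)) :=
      (Complex.contDiffAt_log hz).restrict_scalars ℝ
    have h3 : ContDiffAt ℝ ∞ (fun w : ℂ => w * Complex.exp (-t * Complex.I)) (circleVal z) := by fun_prop
    have h4 := h2.comp (circleVal z) h3
    exact contDiffAt_const.add (Complex.imCLM.contDiff.contDiffAt.comp (circleVal z) h4)
  exact (h1.contMDiffAt.comp z (contMDiff_circleVal z)).contMDiffWithinAt

theorem exp_mem_circleArc {t s : ℝ} (h : s ∈ Set.Ioo (t - Real.pi) (t + Real.pi)) :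
    Circle.exp s ∈ circleArc t := by
  rw [circleArc, Set.mem_ofPred_eq, Circle.coe_exp, ← Complex.exp_add,
    show (s : ℂ) * Complex.I + -t * Complex.I = ((s - t : ℝ) : ℂ) * Complex.I by push_cast; ring,
    Complex.mem_slitPlane_iff_arg, Complex.arg_exp_mul_I,
    (toIocMod_eq_self Real.two_pi_pos).2 ⟨by linarith [h.1], by linarith [h.2]⟩]
  exact ⟨by linarith [h.2], Complex.exp_ne_zero _⟩

theorem circleLift_mem {t : ℝ} {z : Circle} (h : z ∈ circleArc t) :
    circleLift t z ∈ Set.Ioo (t - Real.pi) (t + Real.pi) := by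
  have h1 := Complex.mem_slitPlane_iff_arg.1 h
  have h2 := Complex.neg_pi_lt_arg ((z : ℂ) * Complex.exp (-t * Complex.I))
  have h3 := Complex.arg_le_pi ((z : ℂ) * Complex.exp (-t * Complex.I))
  have h4 := lt_of_le_of_ne h3 h1.1
  rw [circleLift, Complex.log_im]
  constructor <;> linarith

/-- The coordinates `torusCoord` near `u`, as a partial diffeomorphism. -/
def torusPartialDiffeomorph (u : Fin 3 → ℝ) :
    PartialDiffeomorph 𝓘(ℝ, Fin 3 → ℝ) lineTorusModel (Fin 3 → ℝ) LineTorus ∞ where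
  toFun := torusCoord
  invFun p := ![p.1, circleLift (u 1) p.2.1, circleLift (u 2) p.2.2]
  source := {v | v 1 ∈ Set.Ioo (u 1 - Real.pi) (u 1 + Real.pi) ∧
    v 2 ∈ Set.Ioo (u 2 - Real.pi) (u 2 + Real.pi)}
  target := {p | p.2.1 ∈ circleArc (u 1) ∧ p.2.2 ∈ circleArc (u 2)}
  map_source' v hv := ⟨exp_mem_circleArc hv.1, exp_mem_circleArc hv.2⟩
  map_target' p hp := ⟨circleLift_mem hp.1, circleLift_mem hp.2⟩
  left_inv' v hv := by
    ext i
    fin_cases i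
    · rfl
    · exact circleLift_exp hv.1
    · exact circleLift_exp hv.2
  right_inv' p hp := Prod.ext rfl (Prod.ext (exp_circleLift _ _) (exp_circleLift _ _))
  open_source := (isOpen_Ioo.preimage (continuous_apply 1)).inter
    (isOpen_Ioo.preimage (continuous_apply 2))
  open_target := ((isOpen_circleArc _).preimage (by fun_prop)).inter
    ((isOpen_circleArc _).preimage (by fun_prop))
  contMDiffOn_toFun := contMDiff_torusCoord.contMDiffOn
  contMDiffOn_invFun := by
    rw [contMDiffOn_pi_space]
    intro i
    fin_cases i
    · exact contMDiff_fst.contMDiffOn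
    · exact (contMDiffOn_circleLift (u 1)).comp
        (contMDiff_fst.comp contMDiff_snd).contMDiffOn fun p hp => hp.1
    · exact (contMDiffOn_circleLift (u 2)).comp
        (contMDiff_snd.comp contMDiff_snd).contMDiffOn fun p hp => hp.2

theorem isCoordinatesAt_torusCoord (u : Fin 3 → ℝ) :
    IsCoordinatesAt lineTorusModel torusCoord u (torusCoord u) :=
  ⟨(torusPartialDiffeomorph u).isLocalDiffeomorphAt _ _ _
    ⟨by constructor <;> linarith [Real.pi_pos], by constructor <;> linarith [Real.pi_pos]⟩, rfl⟩

theorem exists_torusCoord_eq (p : LineTorus) : ∃ u : Fin 3 → ℝ, torusCoord u = p ∧ u 0 = p.1 :=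
  ⟨![p.1, circleLift 0 p.2.1, circleLift 0 p.2.2],
    Prod.ext rfl (Prod.ext (exp_circleLift _ _) (exp_circleLift _ _)), rfl⟩

end Soliton

end

/-! ### Curvature and the soliton equation of a warped metric. -/

noncomputable section

namespace Soliton

theorem partialDeriv_const {n : ℕ} (i : Fin n) (c : ℝ) (u : Fin n → ℝ) :
    partialDeriv i (fun _ => c) u = 0 := by
  simp [partialDeriv]

theorem partialDeriv_radial (i : Fin 3) {ψ : ℝ → ℝ} {ψ' : ℝ} {u : Fin 3 → ℝ}
    (hψ : HasDerivAt ψ ψ' (u 0)) :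
    partialDeriv i (fun w => ψ (w 0)) u = if i = 0 then ψ' else 0 := by
  have h : HasFDerivAt (fun w : Fin 3 → ℝ => ψ (w 0))
      (ψ' • ContinuousLinearMap.proj (R := ℝ) (φ := fun _ : Fin 3 => ℝ) 0) u :=
    hψ.comp_hasFDerivAt u (hasFDerivAt_apply 0 u)
  rw [partialDeriv, h.fderiv]
  fin_cases i <;> simp

/-- The metric `dr² + e^{2h(r)} (dx² + dy²)` in the coordinates `(r, x, y)`. -/
def warpedGram (h : ℝ → ℝ) (u : Fin 3 → ℝ) : Matrix (Fin 3) (Fin 3) ℝ :=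
  Matrix.diagonal ![1, Real.exp (2 * h (u 0)), Real.exp (2 * h (u 0))]

theorem warpedGram_inv (h : ℝ → ℝ) (u : Fin 3 → ℝ) :
    (warpedGram h u)⁻¹ =
      Matrix.diagonal ![1, (Real.exp (2 * h (u 0)))⁻¹, (Real.exp (2 * h (u 0)))⁻¹] := by
  apply Matrix.inv_eq_right_inv
  rw [warpedGram, Matrix.diagonal_mul_diagonal, ← Matrix.diagonal_one]
  congr 1
  ext i
  fin_cases i <;> simp

theorem hasDerivAt_exp_two_mul {h : ℝ → ℝ} (hh : ContDiff ℝ ∞ h) (r : ℝ) :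
    HasDerivAt (fun r => Real.exp (2 * h r)) (2 * deriv h r * Real.exp (2 * h r)) r := by
  have h1 : HasDerivAt h (deriv h r) r := (hh.differentiable (by simp) r).hasDerivAt
  convert (h1.const_mul 2).exp using 1
  ring

theorem hasDerivAt_deriv_of_smooth {h : ℝ → ℝ} (hh : ContDiff ℝ ∞ h) (r : ℝ) :
    HasDerivAt (deriv h) (deriv (deriv h) r) r :=
  (((contDiff_infty_iff_deriv.1 hh).2).differentiable (by simp) r).hasDerivAt

theorem partialDeriv_warpedGram {h : ℝ → ℝ} (hh : ContDiff ℝ ∞ h) (i j l : Fin 3)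
    (u : Fin 3 → ℝ) :
    partialDeriv i (fun w => warpedGram h w j l) u =
      if i = 0 ∧ j = l ∧ j ≠ 0 then 2 * deriv h (u 0) * Real.exp (2 * h (u 0)) else 0 := by
  by_cases hjl : j = l
  · subst hjl
    by_cases hj : j = 0
    · subst hj
      simp [warpedGram, partialDeriv_const]
    · have : (fun w => warpedGram h w j j) = fun w => Real.exp (2 * h (w 0)) := by
        ext w
        fin_cases j <;> simp [warpedGram] at hj ⊢
      rw [this, partialDeriv_radial i (hasDerivAt_exp_two_mul hh (u 0))]
      simp [hj]
  · simp [warpedGram, hjl, partialDeriv_const]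

/-- The Christoffel symbols of `dr² + e^{2h(r)} (dx² + dy²)`. -/
def warpedChristoffel (h : ℝ → ℝ) (r : ℝ) : Fin 3 → Fin 3 → Fin 3 → ℝ :=
  ![![![0, 0, 0], ![0, -(deriv h r * Real.exp (2 * h r)), 0],
      ![0, 0, -(deriv h r * Real.exp (2 * h r))]],
    ![![0, deriv h r, 0], ![deriv h r, 0, 0], ![0, 0, 0]],
    ![![0, 0, deriv h r], ![0, 0, 0], ![deriv h r, 0, 0]]]

/-- The radial derivatives of the Christoffel symbols of `dr² + e^{2h(r)} (dx² + dy²)`. -/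
def warpedChristoffelDeriv (h : ℝ → ℝ) (r : ℝ) : Fin 3 → Fin 3 → Fin 3 → ℝ :=
  ![![![0, 0, 0], ![0, -((deriv (deriv h) r + 2 * deriv h r ^ 2) * Real.exp (2 * h r)), 0],
      ![0, 0, -((deriv (deriv h) r + 2 * deriv h r ^ 2) * Real.exp (2 * h r))]],
    ![![0, deriv (deriv h) r, 0], ![deriv (deriv h) r, 0, 0], ![0, 0, 0]],
    ![![0, 0, deriv (deriv h) r], ![0, 0, 0], ![deriv (deriv h) r, 0, 0]]]

theorem christoffel_warpedGram {h : ℝ → ℝ} (hh : ContDiff ℝ ∞ h) (k i j : Fin 3) :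
    christoffel (warpedGram h) k i j = fun u => warpedChristoffel h (u 0) k i j := by
  ext u
  have h0 := Real.exp_ne_zero (2 * h (u 0))
  simp only [christoffel, partialDeriv_warpedGram hh, warpedGram_inv, Fin.sum_univ_three]
  fin_cases k <;> fin_cases i <;> fin_cases j <;>
    simp [warpedChristoffel] <;> field_simp

theorem hasDerivAt_warpedChristoffel {h : ℝ → ℝ} (hh : ContDiff ℝ ∞ h) (k i j : Fin 3) (r : ℝ) :
    HasDerivAt (fun r => warpedChristoffel h r k i j) (warpedChristoffelDeriv h r k i j) r := by
  have h1 := hasDerivAt_deriv_of_smooth hh r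
  have h2 : HasDerivAt (fun r => -(deriv h r * Real.exp (2 * h r)))
      (-((deriv (deriv h) r + 2 * deriv h r ^ 2) * Real.exp (2 * h r))) r := by
    exact ((h1.mul (hasDerivAt_exp_two_mul hh r)).neg).congr_deriv (by ring)
  have h3 := hasDerivAt_const r (0 : ℝ)
  fin_cases k <;> fin_cases i <;> fin_cases j <;> first | exact h3 | exact h1 | exact h2

/-- The sectional curvatures of the coordinate planes of `dr² + e^{2h(r)} (dx² + dy²)`. -/
def warpedCurvature (h : ℝ → ℝ) (r : ℝ) (i j : Fin 3) : ℝ :=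
  if i = 0 ∨ j = 0 then -(deriv (deriv h) r + deriv h r ^ 2) else -deriv h r ^ 2

/-- The coordinate planes diagonalize the curvature operator: only two values occur, according to
whether the plane contains the radial direction. -/
theorem riemann_warpedGram {h : ℝ → ℝ} (hh : ContDiff ℝ ∞ h) (l k i j : Fin 3) (u : Fin 3 → ℝ) :
    riemann (warpedGram h) l k i j u = warpedCurvature h (u 0) i j *
      ((if l = i then warpedGram h u j k else 0) - (if l = j then warpedGram h u i k else 0)) := by
  simp only [riemann, christoffel_warpedGram hh,
    partialDeriv_radial _ (hasDerivAt_warpedChristoffel hh _ _ _ (u 0)), Fin.sum_univ_three]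
  fin_cases l <;> fin_cases k <;> fin_cases i <;> fin_cases j <;>
    simp [warpedChristoffel, warpedChristoffelDeriv, warpedCurvature, warpedGram] <;> ring

theorem ricci_warpedGram {h : ℝ → ℝ} (hh : ContDiff ℝ ∞ h) (j k : Fin 3) (u : Fin 3 → ℝ) :
    ricci (warpedGram h) j k u = Matrix.diagonal ![-2 * (deriv (deriv h) (u 0) + deriv h (u 0) ^ 2),
      -(deriv (deriv h) (u 0) + 2 * deriv h (u 0) ^ 2) * Real.exp (2 * h (u 0)),
      -(deriv (deriv h) (u 0) + 2 * deriv h (u 0) ^ 2) * Real.exp (2 * h (u 0))] j k := by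
  simp only [ricci, riemann_warpedGram hh, Fin.sum_univ_three]
  fin_cases j <;> fin_cases k <;> simp [warpedCurvature, warpedGram] <;> ring

theorem hessian_warpedGram {h φ : ℝ → ℝ} (hh : ContDiff ℝ ∞ h) (hφ : ContDiff ℝ ∞ φ)
    (i j : Fin 3) (u : Fin 3 → ℝ) :
    hessian (warpedGram h) (fun w => φ (w 0)) i j u =
      Matrix.diagonal ![deriv (deriv φ) (u 0), deriv h (u 0) * deriv φ (u 0) * Real.exp (2 * h (u 0)),
        deriv h (u 0) * deriv φ (u 0) * Real.exp (2 * h (u 0))] i j := by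
  have h1 : ∀ k : Fin 3, partialDeriv k (fun w : Fin 3 → ℝ => φ (w 0)) =
      fun u => if k = 0 then deriv φ (u 0) else 0 := fun k => by
    ext u
    exact partialDeriv_radial k (hφ.differentiable (by simp) (u 0)).hasDerivAt
  have h2 : partialDeriv i (fun u : Fin 3 → ℝ => if j = 0 then deriv φ (u 0) else 0) u =
      if i = 0 ∧ j = 0 then deriv (deriv φ) (u 0) else 0 := by
    by_cases hj : j = 0
    · simp only [hj, if_true, and_true]
      exact partialDeriv_radial i (hasDerivAt_deriv_of_smooth hφ (u 0))
    · simp [hj, partialDeriv_const]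
  simp only [hessian, h1, h2, christoffel_warpedGram hh, Fin.sum_univ_three]
  fin_cases i <;> fin_cases j <;> simp [warpedChristoffel] <;> ring

/-- With `p` and `q` the parts of the squared area of `a ∧ b` in the radial planes and in the torus
plane, the sectional curvature is the average of the two principal curvatures with weights `p` and
`q`. This is why convexity of `S` is enough. -/
theorem sectional_warpedGram_mem {h : ℝ → ℝ} (hh : ContDiff ℝ ∞ h) {u : Fin 3 → ℝ} {S : Set ℝ}
    (hS : Convex ℝ S) (h0 : -(deriv (deriv h) (u 0) + deriv h (u 0) ^ 2) ∈ S)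
    (h1 : -deriv h (u 0) ^ 2 ∈ S) {a b : Fin 3 → ℝ} (hab : LinearIndependent ℝ ![a, b]) :
    sectional (warpedGram h) u a b ∈ S := by
  set e := Real.exp (2 * h (u 0)) with he
  have hpos : 0 < e := Real.exp_pos _
  set p := e * ((a 0 * b 1 - a 1 * b 0) ^ 2 + (a 0 * b 2 - a 2 * b 0) ^ 2) with hp
  set q := e ^ 2 * (a 1 * b 2 - a 2 * b 1) ^ 2 with hq
  have hp0 : 0 ≤ p := by positivity
  have hq0 : 0 ≤ q := by positivity
  have hden : innerAt (warpedGram h) u a a * innerAt (warpedGram h) u b b -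
      innerAt (warpedGram h) u a b ^ 2 = p + q := by
    simp [innerAt, warpedGram, Fin.sum_univ_three, Matrix.diagonal, ← he, hp, hq]
    ring
  have hnum : innerAt (warpedGram h) u (fun l => ∑ k, ∑ i, ∑ j,
      riemann (warpedGram h) l k i j u * a i * b j * b k) a =
      -(deriv (deriv h) (u 0) + deriv h (u 0) ^ 2) * p + -deriv h (u 0) ^ 2 * q := by
    simp [riemann_warpedGram hh, innerAt, warpedGram, warpedCurvature, Fin.sum_univ_three,
      Matrix.diagonal, ← he, hp, hq]
    ring
  have hpq : 0 < p + q := by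
    by_contra! hle
    have hp' : p = 0 := by linarith
    have hq' : q = 0 := by linarith
    have e1 : (a 0 * b 1 - a 1 * b 0) ^ 2 + (a 0 * b 2 - a 2 * b 0) ^ 2 = 0 := by
      simpa [hp, hpos.ne'] using hp'
    have e2 : a 1 * b 2 - a 2 * b 1 = 0 := by
      simpa [hq, hpos.ne'] using hq'
    have e3 : a 0 * b 1 - a 1 * b 0 = 0 := by nlinarith [sq_nonneg (a 0 * b 1 - a 1 * b 0), sq_nonneg (a 0 * b 2 - a 2 * b 0)]
    have e4 : a 0 * b 2 - a 2 * b 0 = 0 := by nlinarith [sq_nonneg (a 0 * b 1 - a 1 * b 0), sq_nonneg (a 0 * b 2 - a 2 * b 0)]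
    rw [LinearIndependent.pair_iff] at hab
    -- If all `2 × 2` minors vanish, then `bᵢ a - aᵢ b = 0` for every `i`, and independence forces
    -- `aᵢ = 0`.
    have key : ∀ i, a i = 0 := by
      intro i
      refine neg_eq_zero.1 (hab (b i) (-a i) ?_).2
      ext j
      fin_cases i <;> fin_cases j <;> simp <;> linarith
    have := (hab 1 0 (by ext j; simp [key j])).1
    norm_num at this
  rw [sectional, hden, hnum]
  convert hS h0 h1 (div_nonneg hp0 hpq.le) (div_nonneg hq0 hpq.le) (by field_simp) using 1
  simp only [smul_eq_mul]
  field_simp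

theorem gram_eq_warpedGram {g : LineTorusMetric} {h : ℝ → ℝ} (hg : IsWarpedMetric g h) :
    gram g torusCoord = warpedGram h :=
  funext hg

theorem sectionalCurvatureMem_of_isWarpedMetric {g : LineTorusMetric} {h : ℝ → ℝ}
    (hh : ContDiff ℝ ∞ h) (hg : IsWarpedMetric g h) {S : Set ℝ} (hS : Convex ℝ S) (p : LineTorus)
    (h0 : -(deriv (deriv h) p.1 + deriv h p.1 ^ 2) ∈ S) (h1 : -deriv h p.1 ^ 2 ∈ S) :
    SectionalCurvatureMem g p S := by
  obtain ⟨u, rfl, -⟩ := exists_torusCoord_eq p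
  refine ⟨3, torusCoord, u, isCoordinatesAt_torusCoord u, fun a b hab => ?_⟩
  rw [gram_eq_warpedGram hg]
  exact sectional_warpedGram_mem hh hS h0 h1 hab

theorem sectionalCurvatureTendsto_of_isWarpedMetric {g : LineTorusMetric} {h : ℝ → ℝ}
    (hh : ContDiff ℝ ∞ h) (hg : IsWarpedMetric g h) {l : Filter ℝ} {κ : ℝ}
    (h0 : Tendsto (fun r => -(deriv (deriv h) r + deriv h r ^ 2)) l (𝓝 κ))
    (h1 : Tendsto (fun r => -deriv h r ^ 2) l (𝓝 κ)) :
    SectionalCurvatureTendsto g l κ := by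
  intro δ hδ
  have hnhds : Set.Ioo (κ - δ) (κ + δ) ∈ 𝓝 κ := Ioo_mem_nhds (by linarith) (by linarith)
  filter_upwards [h0 hnhds, h1 hnhds] with r hr0 hr1 z w
  exact sectionalCurvatureMem_of_isWarpedMetric hh hg (convex_Ioo _ _) _ hr0 hr1

theorem isGradientRicciSoliton_of_isWarpedMetric {g : LineTorusMetric} {h φ : ℝ → ℝ}
    (hh : ContDiff ℝ ∞ h) (hφ : ContDiff ℝ ∞ φ) (hg : IsWarpedMetric g h)
    (hH : ∀ r, deriv (deriv h) r = deriv h r * deriv φ r - 2 * deriv h r ^ 2 + 1 / 2)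
    (hF : ∀ r, deriv (deriv φ) r = 2 * deriv h r * deriv φ r - 2 * deriv h r ^ 2 + 1 / 2) :
    IsGradientRicciSoliton g (fun p => φ p.1) 1 := by
  refine ⟨hφ.contMDiff.comp contMDiff_fst, fun p => ?_⟩
  obtain ⟨u, rfl, -⟩ := exists_torusCoord_eq p
  refine ⟨3, torusCoord, u, isCoordinatesAt_torusCoord u, fun i j => ?_⟩
  have hcomp : (fun p : LineTorus => φ p.1) ∘ torusCoord = fun w => φ (w 0) := rfl
  rw [gram_eq_warpedGram hg, hcomp, ricci_warpedGram hh, hessian_warpedGram hh hφ]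
  fin_cases i <;> fin_cases j <;> simp [warpedGram, hH, hF] <;> ring

end Soliton

end

/-! ### Power series for the unstable manifold of the saddle. -/

noncomputable section

/-- The sum `∑ aₙ sⁿ⁺¹`. -/
def shiftedSeries (a : ℕ → ℝ) (s : ℝ) : ℝ := ∑' n, a n * s ^ (n + 1)

section ShiftedSeries

variable {a b : ℕ → ℝ} {A : ℝ}

theorem summable_coeff_mul_pow (ha : ∀ n, |a n| ≤ A) {s : ℝ} (hs : |s| < 1) (k : ℕ) :
    Summable fun n => ‖a n * s ^ (n + k)‖ := by
  refine Summable.of_nonneg_of_le (fun n => norm_nonneg _) (fun n => ?_)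
    ((summable_geometric_of_lt_one (abs_nonneg s) hs).mul_left (A * |s| ^ k))
  rw [norm_mul, norm_pow, Real.norm_eq_abs, Real.norm_eq_abs, pow_add]
  calc |a n| * (|s| ^ n * |s| ^ k) ≤ A * (|s| ^ n * |s| ^ k) := by
        gcongr
        exact ha n
    _ = A * |s| ^ k * |s| ^ n := by ring

theorem summable_succ_mul_pow {s : ℝ} (hs : |s| < 1) :
    Summable fun n : ℕ => ((n : ℝ) + 1) * |s| ^ n := by
  have h1 := summable_pow_mul_geometric_of_norm_lt_one 1 (r := |s|) (by simpa using hs)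
  have h2 := summable_geometric_of_lt_one (abs_nonneg s) hs
  refine (h1.add h2).congr fun n => ?_
  simp only [pow_one]
  ring

theorem hasDerivAt_shiftedSeries (ha : ∀ n, |a n| ≤ A) {s : ℝ} (hs : |s| < 1) :
    HasDerivAt (shiftedSeries a) (∑' n, a n * ((n + 1) * s ^ n)) s := by
  -- An intermediate radius gives the termwise derivatives a summable bound that is uniform near
  -- `s`.
  obtain ⟨ρ, hρ1, hρ2⟩ := exists_between hs
  have hρ0 : 0 < ρ := (abs_nonneg s).trans_lt hρ1
  have hsum : Summable fun n : ℕ => A * (((n : ℝ) + 1) * ρ ^ n) := by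
    have := summable_succ_mul_pow (s := ρ) (by rwa [abs_of_pos hρ0])
    rw [abs_of_pos hρ0] at this
    exact this.mul_left A
  refine hasDerivAt_tsum_of_isPreconnected (t := Set.Ioo (-ρ) ρ) (y₀ := 0)
    (g := fun n y => a n * y ^ (n + 1)) (g' := fun n y => a n * ((n + 1) * y ^ n))
    hsum isOpen_Ioo isPreconnected_Ioo ?_ ?_ ⟨by linarith, hρ0⟩ ?_ (abs_lt.1 hρ1)
  · intro n y _
    simpa using (hasDerivAt_pow (n + 1) y).const_mul (a n)
  · intro n y hy
    have hy' : |y| ≤ ρ := (abs_lt.2 hy).le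
    rw [norm_mul, norm_mul, norm_pow, Real.norm_eq_abs, Real.norm_eq_abs, Real.norm_eq_abs,
      abs_of_nonneg (by positivity : (0 : ℝ) ≤ n + 1)]
    have hA : 0 ≤ A := (abs_nonneg _).trans (ha 0)
    gcongr
    exact ha n
  · exact (summable_coeff_mul_pow ha (by simp) 1).of_norm

theorem shiftedSeries_zero : shiftedSeries a 0 = 0 := by
  simp [shiftedSeries]

theorem shiftedSeries_mul (ha : ∀ n, |a n| ≤ A) (hb : ∀ n, |b n| ≤ A) {s : ℝ} (hs : |s| < 1) :
    HasSum (fun n => (∑ ij ∈ Finset.HasAntidiagonal.antidiagonal n, a ij.1 * b ij.2) * s ^ (n + 2))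
      (shiftedSeries a s * shiftedSeries b s) := by
  have h1 := summable_coeff_mul_pow ha hs 1
  have h2 := summable_coeff_mul_pow hb hs 1
  have h3 : ∀ n, ∑ ij ∈ Finset.HasAntidiagonal.antidiagonal n, (a ij.1 * s ^ (ij.1 + 1)) * (b ij.2 * s ^ (ij.2 + 1)) =
      (∑ ij ∈ Finset.HasAntidiagonal.antidiagonal n, a ij.1 * b ij.2) * s ^ (n + 2) := by
    intro n
    rw [Finset.sum_mul]
    refine Finset.sum_congr rfl fun ij hij => ?_
    rw [← Finset.HasAntidiagonal.mem_antidiagonal.1 hij]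
    ring
  have h4 := (summable_norm_sum_mul_antidiagonal_of_summable_norm h1 h2).of_norm
  have h5 := tsum_mul_tsum_eq_tsum_sum_antidiagonal_of_summable_norm h1 h2
  rw [shiftedSeries, shiftedSeries, h5]
  simp only [h3] at h4 ⊢
  exact h4.hasSum

/-- A linear recursion with quadratic forcing for the coefficients gives a differential equation
for the sums of the series. -/
theorem shiftedSeries_ode (ha : ∀ n, |a n| ≤ A) (hb : ∀ n, |b n| ≤ A)
    {c : ℕ → ℝ} (hc : ∀ n, |c n| ≤ A) {μ k l p q : ℝ}
    (h0 : μ * c 0 = k * a 0 + l * b 0)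
    (hsucc : ∀ n : ℕ, ((n : ℝ) + 2) * μ * c (n + 1) = k * a (n + 1) + l * b (n + 1) +
      (p * ∑ ij ∈ Finset.HasAntidiagonal.antidiagonal n, a ij.1 * b ij.2) +
      (q * ∑ ij ∈ Finset.HasAntidiagonal.antidiagonal n, a ij.1 * a ij.2)) {s : ℝ} (hs : |s| < 1) :
    μ * s * (∑' n, c n * ((n + 1) * s ^ n)) = k * shiftedSeries a s + l * shiftedSeries b s +
      p * (shiftedSeries a s * shiftedSeries b s) + q * (shiftedSeries a s * shiftedSeries a s) := by
  have hA := (summable_coeff_mul_pow ha hs 1).of_norm.hasSum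
  have hB := (summable_coeff_mul_pow hb hs 1).of_norm.hasSum
  have hab := shiftedSeries_mul ha hb hs
  have haa := shiftedSeries_mul ha ha hs
  have hlin := (hA.mul_left k).add (hB.mul_left l)
  rw [← hasSum_nat_add_iff' 1] at hlin
  have hfull := (hlin.add (hab.mul_left p)).add (haa.mul_left q)
  have hD : HasSum (fun n : ℕ => μ * s * (c n * ((n + 1) * s ^ n)))
      (μ * s * ∑' n, c n * ((n + 1) * s ^ n)) := by
    refine (Summable.hasSum ?_).mul_left _
    refine Summable.of_norm (Summable.of_nonneg_of_le (fun n => norm_nonneg _) (fun n => ?_)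
      ((summable_succ_mul_pow hs).mul_left A))
    rw [norm_mul, norm_mul, norm_pow, Real.norm_eq_abs, Real.norm_eq_abs, Real.norm_eq_abs,
      abs_of_nonneg (by positivity : (0 : ℝ) ≤ n + 1)]
    gcongr
    exact hc n
  -- The quadratic terms begin at `s²`, so the linear term `n = 0` is split off on both sides: `h0`
  -- treats it, and `hsucc` matches all higher coefficients.
  rw [← hasSum_nat_add_iff' 1] at hD
  have hterm : (fun n : ℕ => μ * s * (c (n + 1) * (((n + 1 : ℕ) + 1) * s ^ (n + 1)))) =
      fun n : ℕ => k * (a (n + 1) * s ^ (n + 1 + 1)) + l * (b (n + 1) * s ^ (n + 1 + 1)) +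
        p * ((∑ ij ∈ Finset.HasAntidiagonal.antidiagonal n, a ij.1 * b ij.2) * s ^ (n + 2)) +
        q * ((∑ ij ∈ Finset.HasAntidiagonal.antidiagonal n, a ij.1 * a ij.2) * s ^ (n + 2)) := by
    ext n
    have := hsucc n
    push_cast
    linear_combination s ^ (n + 2) * this
  rw [hterm] at hD
  have := hD.unique hfull
  simp only [Finset.range_one, Finset.sum_singleton] at this
  change _ - _ = k * shiftedSeries a s + l * shiftedSeries b s - _ + _ + _ at this
  simp only [zero_add, pow_one, Nat.cast_zero, pow_zero] at this
  linear_combination this + s * h0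

end ShiftedSeries

namespace Soliton

/-- The positive eigenvalue `(√5 - 1) / 2` of the linearization at the saddle point. -/
def unstableRate : ℝ := (√5 - 1) / 2

theorem unstableRate_sq : unstableRate ^ 2 = 1 - unstableRate := by
  have := Real.sq_sqrt (show (0 : ℝ) ≤ 5 by norm_num)
  rw [unstableRate]
  nlinarith

theorem unstableRate_bounds : 3 / 5 < unstableRate ∧ unstableRate < 5 / 8 := by
  have h1 : (11 / 5 : ℝ) < √5 := Real.lt_sqrt_of_sq_lt (by norm_num)
  have h2 : √5 < (9 / 4 : ℝ) := (Real.sqrt_lt' (by norm_num)).2 (by norm_num)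
  rw [unstableRate]
  constructor <;> linarith

/-- The Taylor coefficients of the unstable manifold of the saddle point `(1/2, 0)`. -/
def unstableCoeff : ℕ → ℝ × ℝ
  -- This is `-1/120` times the eigenvector `(1, 2(2 + λ))`. The sign selects the branch with `H <
  -- 1/2` and `F < 0`; the small factor lets the induction bound on the coefficients close.
  | 0 => (-(1 / 120), -((2 + unstableRate) / 60))
  | n + 1 =>
    let p := ∑ i : Fin (n + 1), (unstableCoeff i).1 * (unstableCoeff (n - i)).2
    let q := ∑ i : Fin (n + 1), (unstableCoeff i).1 * (unstableCoeff (n - i)).1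
    let m := ((n : ℝ) + 2) * unstableRate
    -- Cramer's rule for `(m - A) c = (p - 2q, 2p - 2q)`, where `A` is the linearization with rows
    -- `(-2, 1/2)` and `(-2, 1)`, and `m² + m - 1 = det (m - A)`.
    (((m - 1) * (p - 2 * q) + (p - q)) / (m ^ 2 + m - 1),
      ((m + 2) * (2 * p - 2 * q) - 2 * (p - 2 * q)) / (m ^ 2 + m - 1))
  decreasing_by all_goals omega

theorem sum_fin_eq_sum_antidiagonal (n : ℕ) (f : ℕ → ℕ → ℝ) :
    ∑ i : Fin (n + 1), f i (n - i) = ∑ ij ∈ Finset.HasAntidiagonal.antidiagonal n, f ij.1 ij.2 := by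
  rw [Finset.Nat.sum_antidiagonal_eq_sum_range_succ f, Finset.sum_range fun i => f i (n - i)]

theorem unstableCoeff_succ (n : ℕ) :
    unstableCoeff (n + 1) =
      let p := ∑ ij ∈ Finset.HasAntidiagonal.antidiagonal n, (unstableCoeff ij.1).1 * (unstableCoeff ij.2).2
      let q := ∑ ij ∈ Finset.HasAntidiagonal.antidiagonal n, (unstableCoeff ij.1).1 * (unstableCoeff ij.2).1
      let m := ((n : ℝ) + 2) * unstableRate
      (((m - 1) * (p - 2 * q) + (p - q)) / (m ^ 2 + m - 1),
        ((m + 2) * (2 * p - 2 * q) - 2 * (p - 2 * q)) / (m ^ 2 + m - 1)) := by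
  rw [unstableCoeff]
  simp only [sum_fin_eq_sum_antidiagonal n fun i j => (unstableCoeff i).1 * (unstableCoeff j).2,
    sum_fin_eq_sum_antidiagonal n fun i j => (unstableCoeff i).1 * (unstableCoeff j).1]

/-- There is no resonance: `(n + 2)λ` exceeds `λ`, the positive root of `m² + m - 1`. -/
theorem resonance_pos (n : ℕ) :
    0 < (((n : ℝ) + 2) * unstableRate) ^ 2 + ((n : ℝ) + 2) * unstableRate - 1 := by
  have h := unstableRate_bounds
  have hn : (0 : ℝ) ≤ n := n.cast_nonneg
  have hm : 6 / 5 < ((n : ℝ) + 2) * unstableRate := by nlinarith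
  nlinarith

/-- If earlier coefficients are at most `1/20`, each convolution is at most `(n + 1)/400`. The
numerators are then linear in `m` times `n + 1`, and the determinant `m² + m - 1` with `m = (n +
2)λ` dominates them. A uniform bound makes the series converge for `|s| < 1`, that is for `r < 0`.
-/
theorem abs_unstableCoeff_le (n : ℕ) :
    |(unstableCoeff n).1| ≤ 1 / 20 ∧ |(unstableCoeff n).2| ≤ 1 / 20 := by
  induction n using Nat.strong_induction_on with
  | _ n ih =>
    have hr := unstableRate_bounds
    rcases n with _ | n
    · rw [unstableCoeff]
      constructor <;> rw [abs_le] <;> constructor <;> simp only <;> linarith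
    · rw [unstableCoeff_succ]
      have hsum : ∀ f g : ℕ → ℝ, (∀ i ≤ n, |f i| ≤ 1 / 20) → (∀ i ≤ n, |g i| ≤ 1 / 20) →
          |∑ ij ∈ Finset.HasAntidiagonal.antidiagonal n, f ij.1 * g ij.2| ≤ (n + 1) / 400 := by
        intro f g hf hg
        refine (Finset.abs_sum_le_sum_abs _ _).trans ?_
        calc ∑ ij ∈ Finset.HasAntidiagonal.antidiagonal n, |f ij.1 * g ij.2|
            ≤ ∑ ij ∈ Finset.HasAntidiagonal.antidiagonal n, (1 / 20 : ℝ) * (1 / 20) := by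
              refine Finset.sum_le_sum fun ij hij => ?_
              have := Finset.HasAntidiagonal.mem_antidiagonal.1 hij
              rw [abs_mul]
              gcongr
              · exact hf _ (by omega)
              · exact hg _ (by omega)
          _ = (n + 1) / 400 := by
              rw [Finset.sum_const, Finset.Nat.card_antidiagonal]
              ring
      have h1 : ∀ i ≤ n, |(unstableCoeff i).1| ≤ 1 / 20 := fun i hi => (ih i (by omega)).1
      have h2 : ∀ i ≤ n, |(unstableCoeff i).2| ≤ 1 / 20 := fun i hi => (ih i (by omega)).2
      have hp := abs_le.1 (hsum (fun i => (unstableCoeff i).1) (fun i => (unstableCoeff i).2) h1 h2)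
      have hq := abs_le.1 (hsum (fun i => (unstableCoeff i).1) (fun i => (unstableCoeff i).1) h1 h1)
      have hΔ := resonance_pos n
      have hn : (0 : ℝ) ≤ n := n.cast_nonneg
      have hsq := unstableRate_sq
      set p := ∑ ij ∈ Finset.HasAntidiagonal.antidiagonal n, (unstableCoeff ij.1).1 * (unstableCoeff ij.2).2
      set q := ∑ ij ∈ Finset.HasAntidiagonal.antidiagonal n, (unstableCoeff ij.1).1 * (unstableCoeff ij.2).1
      set m := ((n : ℝ) + 2) * unstableRate with hm
      have hm1 : 6 / 5 < m := by nlinarith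
      -- The second numerator is the larger one: `4(m + 2) + 6 = 4m + 14` times the convolution
      -- bound.
      have hkey : (4 * m + 14) * ((n + 1) / 400) ≤ (m ^ 2 + m - 1) / 20 := by
        have e1 : m ^ 2 = (n + 2) ^ 2 * (1 - unstableRate) := by rw [hm, mul_pow, hsq]
        have e2 : m ≤ (n + 2) * (5 / 8) := by rw [hm]; gcongr; exact hr.2.le
        have e3 : (n + 2) * (3 / 5) ≤ m := by rw [hm]; gcongr; exact hr.1.le
        have e4 : m ^ 2 ≥ ((n + 2) * (3 / 5)) ^ 2 := by gcongr
        nlinarith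
      simp only
      rw [abs_div, abs_div, abs_of_pos hΔ, div_le_iff₀ hΔ, div_le_iff₀ hΔ, abs_le, abs_le]
      obtain ⟨hp1, hp2⟩ := hp
      obtain ⟨hq1, hq2⟩ := hq
      set t := ((n : ℝ) + 1) / 400
      have ht : 0 ≤ t := by positivity
      refine ⟨⟨?_, ?_⟩, ⟨?_, ?_⟩⟩ <;> nlinarith

theorem unstableCoeff_ode_fst (n : ℕ) :
    ((n : ℝ) + 2) * unstableRate * (unstableCoeff (n + 1)).1 =
      -2 * (unstableCoeff (n + 1)).1 + 1 / 2 * (unstableCoeff (n + 1)).2 +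
      (1 * ∑ ij ∈ Finset.HasAntidiagonal.antidiagonal n, (unstableCoeff ij.1).1 * (unstableCoeff ij.2).2) +
      (-2 * ∑ ij ∈ Finset.HasAntidiagonal.antidiagonal n, (unstableCoeff ij.1).1 * (unstableCoeff ij.2).1) := by
  have hΔ := (resonance_pos n).ne'
  rw [unstableCoeff_succ]
  simp only
  generalize ((n : ℝ) + 2) * unstableRate = m at *
  generalize ∑ ij ∈ Finset.HasAntidiagonal.antidiagonal n, (unstableCoeff ij.1).1 * (unstableCoeff ij.2).2 = p
  generalize ∑ ij ∈ Finset.HasAntidiagonal.antidiagonal n, (unstableCoeff ij.1).1 * (unstableCoeff ij.2).1 = q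
  obtain ⟨D, hD⟩ : ∃ D, D = m ^ 2 + m - 1 := ⟨_, rfl⟩
  rw [← hD] at hΔ ⊢
  field_simp
  rw [hD]
  ring

theorem unstableCoeff_ode_snd (n : ℕ) :
    ((n : ℝ) + 2) * unstableRate * (unstableCoeff (n + 1)).2 =
      -2 * (unstableCoeff (n + 1)).1 + 1 * (unstableCoeff (n + 1)).2 +
      (2 * ∑ ij ∈ Finset.HasAntidiagonal.antidiagonal n, (unstableCoeff ij.1).1 * (unstableCoeff ij.2).2) +
      (-2 * ∑ ij ∈ Finset.HasAntidiagonal.antidiagonal n, (unstableCoeff ij.1).1 * (unstableCoeff ij.2).1) := by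
  have hΔ := (resonance_pos n).ne'
  rw [unstableCoeff_succ]
  simp only
  generalize ((n : ℝ) + 2) * unstableRate = m at *
  generalize ∑ ij ∈ Finset.HasAntidiagonal.antidiagonal n, (unstableCoeff ij.1).1 * (unstableCoeff ij.2).2 = p
  generalize ∑ ij ∈ Finset.HasAntidiagonal.antidiagonal n, (unstableCoeff ij.1).1 * (unstableCoeff ij.2).1 = q
  obtain ⟨D, hD⟩ : ∃ D, D = m ^ 2 + m - 1 := ⟨_, rfl⟩
  rw [← hD] at hΔ ⊢
  field_simp
  rw [hD]
  ring

/-- The two components of the unstable manifold, in terms of `s = e^{λr}`. -/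
def unstableFst (r : ℝ) : ℝ :=
  shiftedSeries (fun n => (unstableCoeff n).1) (Real.exp (unstableRate * r))

/-- The two components of the unstable manifold, in terms of `s = e^{λr}`. -/
def unstableSnd (r : ℝ) : ℝ :=
  shiftedSeries (fun n => (unstableCoeff n).2) (Real.exp (unstableRate * r))

theorem unstableRate_pos : 0 < unstableRate := by
  linarith [unstableRate_bounds.1]

theorem abs_exp_rate_lt_one {r : ℝ} (hr : r < 0) : |Real.exp (unstableRate * r)| < 1 := by
  rw [abs_of_pos (Real.exp_pos _), Real.exp_lt_one_iff]
  exact mul_neg_of_pos_of_neg unstableRate_pos hr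

theorem hasDerivAt_shiftedSeries_exp {a : ℕ → ℝ} {A : ℝ} (ha : ∀ n, |a n| ≤ A) {r : ℝ}
    (hr : r < 0) :
    HasDerivAt (fun r => shiftedSeries a (Real.exp (unstableRate * r)))
      (unstableRate * Real.exp (unstableRate * r) *
        ∑' n, a n * ((n + 1) * Real.exp (unstableRate * r) ^ n)) r := by
  have h1 : HasDerivAt (fun r => Real.exp (unstableRate * r))
      (Real.exp (unstableRate * r) * (unstableRate * 1)) r :=
    ((hasDerivAt_id r).const_mul unstableRate).exp
  have h2 := HasDerivAt.comp (h₂ := shiftedSeries a) r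
    (hasDerivAt_shiftedSeries ha (abs_exp_rate_lt_one hr)) h1
  refine h2.congr_deriv ?_
  ring

theorem hasDerivAt_unstableFst {r : ℝ} (hr : r < 0) :
    HasDerivAt unstableFst (-2 * unstableFst r + 1 / 2 * unstableSnd r +
      1 * (unstableFst r * unstableSnd r) + -2 * (unstableFst r * unstableFst r)) r := by
  have ha := fun n => (abs_unstableCoeff_le n).1
  have hb := fun n => (abs_unstableCoeff_le n).2
  refine (hasDerivAt_shiftedSeries_exp ha hr).congr_deriv
    (shiftedSeries_ode ha hb ha ?_ unstableCoeff_ode_fst (abs_exp_rate_lt_one hr))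
  rw [unstableCoeff]
  simp only
  ring

theorem hasDerivAt_unstableSnd {r : ℝ} (hr : r < 0) :
    HasDerivAt unstableSnd (-2 * unstableFst r + 1 * unstableSnd r +
      2 * (unstableFst r * unstableSnd r) + -2 * (unstableFst r * unstableFst r)) r := by
  have ha := fun n => (abs_unstableCoeff_le n).1
  have hb := fun n => (abs_unstableCoeff_le n).2
  refine (hasDerivAt_shiftedSeries_exp hb hr).congr_deriv
    (shiftedSeries_ode ha hb hb ?_ unstableCoeff_ode_snd (abs_exp_rate_lt_one hr))
  rw [unstableCoeff]
  simp only
  linear_combination (-1 / 60) * unstableRate_sq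

theorem tendsto_exp_rate_atBot :
    Tendsto (fun r => Real.exp (unstableRate * r)) atBot (𝓝[≠] 0) := by
  refine tendsto_nhdsWithin_iff.2 ⟨Real.tendsto_exp_atBot.comp
    (tendsto_id.const_mul_atBot unstableRate_pos), Eventually.of_forall fun r => ?_⟩
  exact (Real.exp_pos _).ne'

theorem tendsto_shiftedSeries_div {a : ℕ → ℝ} {A : ℝ} (ha : ∀ n, |a n| ≤ A) :
    Tendsto (fun r => shiftedSeries a (Real.exp (unstableRate * r)) / Real.exp (unstableRate * r))
      atBot (𝓝 (a 0)) := by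
  have h0 := hasDerivAt_shiftedSeries ha (s := 0) (by simp)
  have h1 : ∑' n, a n * (((n : ℝ) + 1) * 0 ^ n) = a 0 := by
    rw [tsum_eq_single 0 fun n hn => by simp [hn]]
    simp
  rw [h1, hasDerivAt_iff_tendsto_slope] at h0
  refine (h0.comp tendsto_exp_rate_atBot).congr fun r => ?_
  simp [slope_def_field, shiftedSeries_zero]

theorem tendsto_unstableFst_div :
    Tendsto (fun r => unstableFst r / Real.exp (unstableRate * r)) atBot (𝓝 (-(1 / 120))) := by
  have h := tendsto_shiftedSeries_div fun n => (abs_unstableCoeff_le n).1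
  rwa [unstableCoeff] at h

theorem tendsto_unstableSnd_div :
    Tendsto (fun r => unstableSnd r / Real.exp (unstableRate * r)) atBot
      (𝓝 (-((2 + unstableRate) / 60))) := by
  have h := tendsto_shiftedSeries_div fun n => (abs_unstableCoeff_le n).2
  rwa [unstableCoeff] at h

end Soliton
end

/-! ### Barrier arguments and the invariant region. -/

noncomputable section

/-- At a first time where `u` reaches `c`, the weak bound holds up to that time, and `hstep`
contradicts equality. -/
theorem lt_of_bootstrap {u : ℝ → ℝ} {T c : ℝ} (hu : ContinuousOn u (Set.Icc 0 T)) (h0 : u 0 < c)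
    (hstep : ∀ t ∈ Set.Icc 0 T, (∀ s ∈ Set.Icc 0 t, u s ≤ c) → u t < c) :
    ∀ t ∈ Set.Icc 0 T, u t < c := by
  by_contra! hcon
  obtain ⟨t₁, ht₁, hct₁⟩ := hcon
  have hclosed : IsCompact (Set.Icc 0 T ∩ u ⁻¹' Set.Ici c) :=
    isCompact_Icc.of_isClosed_subset (hu.preimage_isClosed_of_isClosed isClosed_Icc isClosed_Ici)
      Set.inter_subset_left
  obtain ⟨t₀, ⟨ht₀, hct₀⟩, hmin⟩ := hclosed.exists_isLeast ⟨t₁, ht₁, hct₁⟩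
  have hlt : ∀ s ∈ Set.Ico 0 t₀, u s < c := by
    intro s hs
    by_contra! h
    exact hs.2.not_ge (hmin ⟨⟨hs.1, hs.2.le.trans ht₀.2⟩, h⟩)
  have heq : u t₀ = c := by
    by_contra hne
    have hgt : c < u t₀ := lt_of_le_of_ne hct₀ (Ne.symm hne)
    obtain ⟨s, hs, hsc⟩ := intermediate_value_Icc ht₀.1
      (hu.mono (Set.Icc_subset_Icc_right ht₀.2)) ⟨h0.le, hgt.le⟩
    have hst : s < t₀ := lt_of_le_of_ne hs.2 (by rintro rfl; exact hne hsc)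
    exact (hlt s ⟨hs.1, hst⟩).ne hsc
  refine (hstep t₀ ht₀ fun s hs => ?_).ne heq
  rcases hs.2.lt_or_eq with h | rfl
  · exact (hlt s ⟨hs.1, h⟩).le
  · exact heq.le

/-- With `m` a lower bound of `a`, the function `u e^{-mt}` is nondecreasing as long as `u ≥ 0`,
since its derivative is `((a - m)u + b) e^{-mt}`. The bootstrap supplies `u ≥ 0`. -/
theorem pos_of_hasDerivAt_linear {u a b : ℝ → ℝ} {T : ℝ}
    (hu : ∀ t ∈ Set.Icc 0 T, HasDerivAt u (a t * u t + b t) t)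
    (ha : ContinuousOn a (Set.Icc 0 T)) (hb : ∀ t ∈ Set.Icc 0 T, 0 ≤ b t) (h0 : 0 < u 0) :
    ∀ t ∈ Set.Icc 0 T, 0 < u t := by
  obtain ⟨m, hm⟩ := (isCompact_Icc.image_of_continuousOn ha).bddBelow
  have hcont : ContinuousOn u (Set.Icc 0 T) := fun t ht => (hu t ht).continuousAt.continuousWithinAt
  suffices h : ∀ t ∈ Set.Icc 0 T, -u t < 0 from fun t ht => neg_lt_zero.1 (h t ht)
  refine lt_of_bootstrap hcont.neg (by simpa using h0) fun t ht hs => ?_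
  have hd : ∀ s, HasDerivAt (fun s => Real.exp (-m * s)) (Real.exp (-m * s) * -m) s := fun s => by
    simpa using ((hasDerivAt_id s).const_mul (-m)).exp
  have hsub : ∀ s ∈ Set.Icc 0 t, s ∈ Set.Icc 0 T := fun s hs => ⟨hs.1, hs.2.trans ht.2⟩
  have hmono : MonotoneOn (fun s => u s * Real.exp (-m * s)) (Set.Icc 0 t) := by
    refine monotoneOn_of_hasDerivWithinAt_nonneg (convex_Icc 0 t) (fun s hs =>
      ((hu s (hsub s hs)).mul (hd s)).continuousAt.continuousWithinAt)
      (fun s hs => ((hu s (hsub s (interior_subset hs))).mul (hd s)).hasDerivWithinAt)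
      fun s hs' => ?_
    have hs'' := interior_subset hs'
    have h1 : 0 ≤ u s := by simpa using hs s hs''
    have h2 : m ≤ a s := hm (Set.mem_image_of_mem a (hsub s hs''))
    have h3 := hb s (hsub s hs'')
    have h4 : 0 ≤ (a s - m) * u s + b s := by
      have := mul_nonneg (sub_nonneg.2 h2) h1
      linarith
    have h5 := mul_nonneg h4 (Real.exp_pos (-m * s)).le
    nlinarith
  have h := hmono ⟨le_rfl, ht.1⟩ ⟨ht.1, le_rfl⟩ ht.1
  simp only [mul_zero, Real.exp_zero, mul_one] at h
  have h6 : 0 < u t * Real.exp (-m * t) := h0.trans_le h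
  simpa using pos_of_mul_pos_left h6 (Real.exp_pos _).le

namespace Soliton

/-- The part of the phase plane in which `0 < H < 1/2`, `F < 0` and `0 < -sec < H²` for the planes
containing the radial direction. -/
def IsPinched (z : ℝ × ℝ) : Prop :=
  0 < z.1 ∧ z.1 < 1 / 2 ∧ z.2 < 0 ∧ 0 < z.1 * z.2 - z.1 ^ 2 + 1 / 2 ∧
    0 < 2 * z.1 ^ 2 - z.1 * z.2 - 1 / 2

theorem hasDerivAt_fst {γ : ℝ → ℝ × ℝ} {v : ℝ × ℝ} {t : ℝ} (h : HasDerivAt γ v t) :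
    HasDerivAt (fun t => (γ t).1) v.1 t :=
  (ContinuousLinearMap.fst ℝ ℝ ℝ).hasFDerivAt.comp_hasDerivAt t h

theorem hasDerivAt_snd {γ : ℝ → ℝ × ℝ} {v : ℝ × ℝ} {t : ℝ} (h : HasDerivAt γ v t) :
    HasDerivAt (fun t => (γ t).2) v.2 t :=
  (ContinuousLinearMap.snd ℝ ℝ ℝ).hasFDerivAt.comp_hasDerivAt t h

/-- Put `K = HF - H² + 1/2`, `Q = 2H² - HF - 1/2` and `D = 1/2 - H`. Then `H' = (F - 2H)H + 1/2`,
`K' = (F - H)K + H³`, `Q' = (F - 3H)Q - H²F` and `D' = -(1 + 2H)D - HF`. Positivity of `H` and `K`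
is thus unconditional, while that of `Q` and `D` needs `F ≤ 0`. Conversely `F' = -2Q + 2H² - 1/2` is
negative while `Q, D > 0`, so a bootstrap on `F < 0` closes the circle. -/
theorem isPinched_of_hasDerivAt {γ : ℝ → ℝ × ℝ} {T : ℝ}
    (hγ : ∀ t ∈ Set.Icc 0 T, HasDerivAt γ (solitonField (γ t)) t) (h0 : IsPinched (γ 0)) :
    ∀ t ∈ Set.Icc 0 T, IsPinched (γ t) := by
  have hH : ∀ t ∈ Set.Icc 0 T, HasDerivAt (fun t => (γ t).1)
      ((γ t).1 * (γ t).2 - 2 * (γ t).1 ^ 2 + 1 / 2) t := fun t ht => hasDerivAt_fst (hγ t ht)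
  have hF : ∀ t ∈ Set.Icc 0 T, HasDerivAt (fun t => (γ t).2)
      (2 * (γ t).1 * (γ t).2 - 2 * (γ t).1 ^ 2 + 1 / 2) t := fun t ht => hasDerivAt_snd (hγ t ht)
  have hcont : ContinuousOn γ (Set.Icc 0 T) :=
    fun t ht => (hγ t ht).continuousAt.continuousWithinAt
  have hHc : ContinuousOn (fun t => (γ t).1) (Set.Icc 0 T) := continuous_fst.comp_continuousOn hcont
  have hFc : ContinuousOn (fun t => (γ t).2) (Set.Icc 0 T) := continuous_snd.comp_continuousOn hcont
  obtain ⟨hH0, hD0, hF0, hK0, hQ0⟩ := h0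
  have hHpos : ∀ t ∈ Set.Icc 0 T, 0 < (γ t).1 :=
    pos_of_hasDerivAt_linear (a := fun t => (γ t).2 - 2 * (γ t).1) (b := fun _ => 1 / 2)
      (fun t ht => (hH t ht).congr_deriv (by ring)) (hFc.sub (hHc.const_mul 2))
      (fun t _ => by norm_num) hH0
  have hKpos : ∀ t ∈ Set.Icc 0 T, 0 < (γ t).1 * (γ t).2 - (γ t).1 ^ 2 + 1 / 2 :=
    pos_of_hasDerivAt_linear (a := fun t => (γ t).2 - (γ t).1) (b := fun t => (γ t).1 ^ 3)
      (fun t ht => ((((hH t ht).mul (hF t ht)).sub ((hH t ht).pow 2)).add_const _).congr_deriv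
        (by simp; ring)) (hFc.sub hHc)
      (fun t ht => (pow_pos (hHpos t ht) 3).le) hK0
  have hQpos : ∀ t ∈ Set.Icc 0 T, (∀ s ∈ Set.Icc 0 t, (γ s).2 ≤ 0) →
      0 < 2 * (γ t).1 ^ 2 - (γ t).1 * (γ t).2 - 1 / 2 := by
    intro t ht hs
    have hsub : ∀ s ∈ Set.Icc 0 t, s ∈ Set.Icc 0 T := fun s hs => ⟨hs.1, hs.2.trans ht.2⟩
    exact pos_of_hasDerivAt_linear (u := fun t => 2 * (γ t).1 ^ 2 - (γ t).1 * (γ t).2 - 1 / 2)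
      (a := fun t => (γ t).2 - 3 * (γ t).1)
      (b := fun t => (γ t).1 ^ 2 * -(γ t).2)
      (fun s hs => (((((hH s (hsub s hs)).pow 2).const_mul 2).sub
        ((hH s (hsub s hs)).mul (hF s (hsub s hs)))).sub_const _).congr_deriv (by simp; ring))
      ((hFc.sub (hHc.const_mul 3)).mono hsub)
      (fun s hs' => mul_nonneg (sq_nonneg _) (neg_nonneg.2 (hs s hs'))) hQ0 t ⟨ht.1, le_rfl⟩
  have hDpos : ∀ t ∈ Set.Icc 0 T, (∀ s ∈ Set.Icc 0 t, (γ s).2 ≤ 0) → 0 < 1 / 2 - (γ t).1 := by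
    intro t ht hs
    have hsub : ∀ s ∈ Set.Icc 0 t, s ∈ Set.Icc 0 T := fun s hs => ⟨hs.1, hs.2.trans ht.2⟩
    exact pos_of_hasDerivAt_linear (u := fun t => 1 / 2 - (γ t).1)
      (a := fun t => -(2 * (1 / 2 + (γ t).1)))
      (b := fun t => (γ t).1 * -(γ t).2)
      (fun s hs => ((hH s (hsub s hs)).const_sub _).congr_deriv (by ring))
      (((hHc.const_add (1 / 2)).const_mul 2).neg.mono hsub)
      (fun s hs' => mul_nonneg (hHpos s (hsub s hs')).le (neg_nonneg.2 (hs s hs'))) (by linarith)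
      t ⟨ht.1, le_rfl⟩
  have hFneg : ∀ t ∈ Set.Icc 0 T, (γ t).2 < 0 := by
    refine lt_of_bootstrap hFc hF0 fun t ht hs => ?_
    have hsub : ∀ s ∈ Set.Icc 0 t, s ∈ Set.Icc 0 T := fun s hs => ⟨hs.1, hs.2.trans ht.2⟩
    have hanti : AntitoneOn (fun t => (γ t).2) (Set.Icc 0 t) := by
      refine antitoneOn_of_hasDerivWithinAt_nonpos (convex_Icc 0 t) (hFc.mono hsub)
        (fun s hs' => (hF s (hsub s (interior_subset hs'))).hasDerivWithinAt) fun s hs' => ?_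
      have hs'' := interior_subset hs'
      have hle : ∀ r ∈ Set.Icc 0 s, (γ r).2 ≤ 0 := fun r hr => hs r ⟨hr.1, hr.2.trans hs''.2⟩
      have h1 := hQpos s (hsub s hs'') hle
      have h2 := hDpos s (hsub s hs'') hle
      have h3 := hHpos s (hsub s hs'')
      nlinarith
    exact (hanti ⟨le_rfl, ht.1⟩ ⟨ht.1, le_rfl⟩ ht.1).trans_lt hF0
  intro t ht
  have hle : ∀ s ∈ Set.Icc 0 t, (γ s).2 ≤ 0 := fun s hs => (hFneg s ⟨hs.1, hs.2.trans ht.2⟩).le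
  exact ⟨hHpos t ht, by linarith [hDpos t ht hle], hFneg t ht, hKpos t ht, hQpos t ht hle⟩

end Soliton
end

/-! ### Existence for all forward times, and gluing. -/

noncomputable section

theorem exists_lipschitzWith_cutoff {V : ℝ × ℝ → ℝ × ℝ} (hV : ContDiff ℝ ∞ V) {R : ℝ} (hR : 0 < R) :
    ∃ (W : ℝ × ℝ → ℝ × ℝ) (K L : NNReal), LipschitzWith K W ∧ (∀ z, ‖W z‖ ≤ L) ∧
      ∀ z, ‖z‖ ≤ R → W z = V z := by
  let χ : ContDiffBump (0 : ℝ × ℝ) := ⟨R, R + 1, hR, by linarith⟩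
  have hW : ContDiff ℝ ∞ fun z => χ z • V z := χ.contDiff.smul hV
  have hsupp : HasCompactSupport fun z => χ z • V z := χ.hasCompactSupport.smul_right
  obtain ⟨K, hK⟩ := (hW.of_le (by simp : (1 : WithTop ℕ∞) ≤ ∞)).lipschitzWith_of_hasCompactSupport hsupp (by simp)
  obtain ⟨L, hL⟩ := hsupp.exists_bound_of_continuous hW.continuous
  refine ⟨_, K, ⟨max L 0, le_max_right _ _⟩, hK, fun z => (hL z).trans (le_max_left _ _), fun z hz => ?_⟩
  rw [χ.one_of_mem_closedBall (by simpa using hz), one_smul]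

theorem exists_hasDerivAt_of_lipschitzWith {W : ℝ × ℝ → ℝ × ℝ} {K L : NNReal}
    (hK : LipschitzWith K W) (hL : ∀ z, ‖W z‖ ≤ L) (z₀ : ℝ × ℝ) {T : ℝ} (hT : 0 ≤ T) :
    ∃ α : ℝ → ℝ × ℝ, α 0 = z₀ ∧ ∀ t ∈ Set.Icc 0 T, HasDerivAt α (W (α t)) t := by
  have hT' : 0 ≤ T + 1 := by linarith
  obtain ⟨S, hS⟩ : ∃ S : NNReal, (S : ℝ) = T + 1 := ⟨⟨T + 1, hT'⟩, rfl⟩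
  -- The interval is enlarged on both sides so that the derivative is two-sided at `0` and at `T`. A
  -- bounded field cannot move the solution farther than `L (T + 1)`.
  have h0mem : (0 : ℝ) ∈ Set.Icc (-1 : ℝ) (T + 1) := ⟨by norm_num, hT'⟩
  have hPL : IsPicardLindelof (fun _ => W) (⟨0, h0mem⟩ : Set.Icc (-1 : ℝ) (T + 1)) z₀ (L * S) 0 L K := by
    refine IsPicardLindelof.of_time_independent (fun z _ => hL z) (hK.lipschitzOnWith) ?_
    rw [max_eq_left (by simp only; linarith), NNReal.coe_mul, hS]
    simp
  obtain ⟨α, h0, hα⟩ := hPL.exists_eq_forall_mem_Icc_hasDerivWithinAt₀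
  refine ⟨α, h0, fun t ht => (hα t ⟨?_, ?_⟩).hasDerivAt (Icc_mem_nhds ?_ ?_)⟩ <;>
    linarith [ht.1, ht.2]

theorem eqOn_of_hasDerivAt {V : ℝ × ℝ → ℝ × ℝ} (hV : ContDiff ℝ ∞ V) {α β : ℝ → ℝ × ℝ} {T : ℝ}
    (hα : ∀ t ∈ Set.Icc 0 T, HasDerivAt α (V (α t)) t)
    (hβ : ∀ t ∈ Set.Icc 0 T, HasDerivAt β (V (β t)) t) (h0 : α 0 = β 0) :
    Set.EqOn α β (Set.Icc 0 T) := by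
  have hαc : ContinuousOn α (Set.Icc 0 T) := fun t ht => (hα t ht).continuousAt.continuousWithinAt
  have hβc : ContinuousOn β (Set.Icc 0 T) := fun t ht => (hβ t ht).continuousAt.continuousWithinAt
  obtain ⟨A, hA⟩ := isCompact_Icc.exists_bound_of_continuousOn hαc
  obtain ⟨B, hB⟩ := isCompact_Icc.exists_bound_of_continuousOn hβc
  obtain ⟨W, K, L, hK, -, hW⟩ := exists_lipschitzWith_cutoff hV (R := max 1 (max A B)) (by positivity)
  have hWα : ∀ t ∈ Set.Icc 0 T, W (α t) = V (α t) := fun t ht => hW _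
    ((hA t ht).trans ((le_max_left _ _).trans (le_max_right _ _)))
  have hWβ : ∀ t ∈ Set.Icc 0 T, W (β t) = V (β t) := fun t ht => hW _
    ((hB t ht).trans ((le_max_right _ _).trans (le_max_right _ _)))
  refine ODE_solution_unique (v := fun _ => W) (fun _ => hK) hαc (fun t ht => ?_) hβc
    (fun t ht => ?_) h0
  · have ht' := Set.Ico_subset_Icc_self ht
    rw [hWα t ht']
    exact (hα t ht').hasDerivWithinAt
  · have ht' := Set.Ico_subset_Icc_self ht
    rw [hWβ t ht']
    exact (hβ t ht').hasDerivWithinAt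

/-- A solution for negative times extends to all times if its end point does. -/
theorem exists_global_extension {V : ℝ × ℝ → ℝ × ℝ} (hV : ContDiff ℝ ∞ V) {γ₀ : ℝ → ℝ × ℝ}
    (hγ₀ : ∀ t ≤ 0, HasDerivAt γ₀ (V (γ₀ t)) t)
    (hex : ∀ T, 0 ≤ T → ∃ α : ℝ → ℝ × ℝ, α 0 = γ₀ 0 ∧ ∀ t ∈ Set.Icc 0 T, HasDerivAt α (V (α t)) t) :
    ∃ γ : ℝ → ℝ × ℝ, (∀ t, HasDerivAt γ (V (γ t)) t) ∧ ∀ t ≤ 0, γ t = γ₀ t := by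
  choose! α hα0 hα using hex
  have heq : ∀ T T' : ℝ, 0 ≤ T → T ≤ T' → Set.EqOn (α T) (α T') (Set.Icc 0 T) := by
    intro T T' hT hTT'
    exact eqOn_of_hasDerivAt hV (hα T hT) (fun t ht => hα T' (hT.trans hTT') t ⟨ht.1, ht.2.trans hTT'⟩)
      ((hα0 T hT).trans (hα0 T' (hT.trans hTT')).symm)
  -- The diagonal choice `α t t` is consistent because solutions on nested intervals agree by
  -- uniqueness.
  set γ : ℝ → ℝ × ℝ := fun t => if t ≤ 0 then γ₀ t else α t t with hγ
  have hneg : ∀ t ≤ 0, γ t = γ₀ t := fun t ht => if_pos ht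
  have hpos : ∀ T, 0 ≤ T → Set.EqOn γ (α T) (Set.Icc 0 T) := by
    intro T hT t ht
    rcases ht.1.eq_or_lt with rfl | h
    · rw [hneg 0 le_rfl, hα0 T hT]
    · rw [hγ]
      simp only [if_neg h.not_ge]
      exact heq t T ht.1 ht.2 ⟨ht.1, le_rfl⟩
  refine ⟨γ, fun t => ?_, hneg⟩
  rcases lt_trichotomy t 0 with ht | rfl | ht
  · rw [hneg t ht.le]
    refine (hγ₀ t ht.le).congr_of_eventuallyEq ?_
    filter_upwards [Iio_mem_nhds ht] with s hs
    exact hneg s (le_of_lt hs)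
  · have h1 : HasDerivWithinAt γ (V (γ 0)) (Set.Iic 0) 0 := by
      rw [hneg 0 le_rfl]
      exact ((hγ₀ 0 le_rfl).hasDerivWithinAt).congr (fun s hs => hneg s hs) (hneg 0 le_rfl)
    have h2 : HasDerivWithinAt γ (V (γ 0)) (Set.Icc 0 1) 0 := by
      have h01 : (0 : ℝ) ∈ Set.Icc (0 : ℝ) 1 := ⟨le_rfl, zero_le_one⟩
      rw [hpos 1 zero_le_one h01]
      exact ((hα 1 zero_le_one 0 h01).hasDerivWithinAt).congr (hpos 1 zero_le_one)
        (hpos 1 zero_le_one h01)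
    refine (h1.union h2).hasDerivAt ?_
    filter_upwards [Iio_mem_nhds (zero_lt_one : (0 : ℝ) < 1)] with s hs
    rcases le_total s 0 with h | h
    · exact Or.inl h
    · exact Or.inr ⟨h, le_of_lt hs⟩
  · have hT : 0 ≤ t + 1 := by linarith
    have ht' : t ∈ Set.Icc 0 (t + 1) := ⟨ht.le, by linarith⟩
    rw [hpos _ hT ht']
    refine (hα _ hT t ht').congr_of_eventuallyEq ?_
    filter_upwards [Icc_mem_nhds ht (by linarith : t < t + 1)] with s hs
    exact hpos _ hT hs

namespace Soliton

theorem contDiff_solitonField : ContDiff ℝ ∞ solitonField := by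
  unfold solitonField
  fun_prop

/-- The cut-off field has a solution up to `T`, and a bootstrap shows that it never leaves the ball
where the cutoff is inactive. There `0 < H < 1/2`, and `F' ≥ -1/2` because `F' = 2K - 1/2` with `K =
HF - H² + 1/2 > 0`. -/
theorem exists_forward_solution {z₀ : ℝ × ℝ} (hz₀ : IsPinched z₀) {T : ℝ} (hT : 0 ≤ T) :
    ∃ α : ℝ → ℝ × ℝ, α 0 = z₀ ∧ ∀ t ∈ Set.Icc 0 T, HasDerivAt α (solitonField (α t)) t := by
  set R := |z₀.2| + T + 1 with hR
  have hRpos : 0 < R := by positivity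
  obtain ⟨W, K, L, hK, hL, hW⟩ := exists_lipschitzWith_cutoff contDiff_solitonField hRpos
  obtain ⟨α, h0, hα⟩ := exists_hasDerivAt_of_lipschitzWith hK hL z₀ hT
  have hcont : ContinuousOn α (Set.Icc 0 T) := fun t ht => (hα t ht).continuousAt.continuousWithinAt
  have hbound : ∀ t ∈ Set.Icc 0 T, ‖α t‖ < R := by
    refine lt_of_bootstrap hcont.norm ?_ fun t ht hs => ?_
    · rw [h0, Prod.norm_def, max_lt_iff, Real.norm_eq_abs, Real.norm_eq_abs, abs_of_pos hz₀.1]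
      constructor
      · linarith [hz₀.2.1, abs_nonneg z₀.2]
      · linarith
    · have hsol : ∀ s ∈ Set.Icc 0 t, HasDerivAt α (solitonField (α s)) s := fun s hs' => by
        rw [← hW _ (hs s hs')]
        exact hα s ⟨hs'.1, hs'.2.trans ht.2⟩
      have hpin := isPinched_of_hasDerivAt hsol (by rwa [h0])
      have hF : ∀ s ∈ Set.Icc 0 t, HasDerivAt (fun s => (α s).2 + s / 2)
          (2 * (α s).1 * (α s).2 - 2 * (α s).1 ^ 2 + 1 / 2 + 1 / 2) s := fun s hs' =>
        (hasDerivAt_snd (hsol s hs')).add ((hasDerivAt_id s).div_const 2)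
      have hmono : MonotoneOn (fun s => (α s).2 + s / 2) (Set.Icc 0 t) :=
        monotoneOn_of_hasDerivWithinAt_nonneg (convex_Icc 0 t)
          (fun s hs' => (hF s hs').continuousAt.continuousWithinAt)
          (fun s hs' => (hF s (interior_subset hs')).hasDerivWithinAt) fun s hs' => by
            have := (hpin s (interior_subset hs')).2.2.2.1
            linarith
      have h1 := hmono ⟨le_rfl, ht.1⟩ ⟨ht.1, le_rfl⟩ ht.1
      simp only [h0, zero_div, add_zero] at h1
      have h2 := hpin t ⟨ht.1, le_rfl⟩
      rw [Prod.norm_def, max_lt_iff, Real.norm_eq_abs, Real.norm_eq_abs, abs_of_pos h2.1,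
        abs_of_neg h2.2.2.1]
      constructor
      · linarith [h2.2.1, abs_nonneg z₀.2]
      · linarith [neg_abs_le z₀.2, ht.2]
  refine ⟨α, h0, fun t ht => ?_⟩
  rw [← hW _ (hbound t ht).le]
  exact hα t ht

end Soliton
end

/-! ### The trajectory leaving the saddle, its smoothness, and primitives. -/

noncomputable section

namespace Soliton

theorem tendsto_exp_rate_atBot_zero :
    Tendsto (fun r => Real.exp (unstableRate * r)) atBot (𝓝 0) :=
  tendsto_exp_rate_atBot.mono_right nhdsWithin_le_nhds

theorem tendsto_zero_of_tendsto_div_exp_rate {u : ℝ → ℝ} {c : ℝ}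
    (hu : Tendsto (fun r => u r / Real.exp (unstableRate * r)) atBot (𝓝 c)) :
    Tendsto u atBot (𝓝 0) := by
  have h := hu.mul tendsto_exp_rate_atBot_zero
  rw [mul_zero] at h
  exact h.congr fun r => div_mul_cancel₀ _ (Real.exp_ne_zero _)

theorem eventually_isPinched_unstable :
    ∀ᶠ r in atBot, IsPinched (1 / 2 + unstableFst r, unstableSnd r) := by
  have hX := tendsto_unstableFst_div
  have hY := tendsto_unstableSnd_div
  have hx := tendsto_zero_of_tendsto_div_exp_rate hX
  have hy := tendsto_zero_of_tendsto_div_exp_rate hY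
  have hrate := unstableRate_pos
  have hH : Tendsto (fun r => 1 / 2 + unstableFst r) atBot (𝓝 (1 / 2)) := by
    have := hx.const_add (1 / 2)
    rwa [add_zero] at this
  have hK : Tendsto (fun r => (1 / 2 + unstableFst r) * unstableSnd r -
      (1 / 2 + unstableFst r) ^ 2 + 1 / 2) atBot (𝓝 (1 / 4)) := by
    have := ((hH.mul hy).sub (hH.pow 2)).add_const (1 / 2)
    norm_num at this ⊢
    exact this
  -- The quantity `2H² - HF - 1/2` vanishes at the saddle, so its sign is read off after division by
  -- `e^{λr}`; the leading coefficient is `-1/60 + (2 + λ)/120 = λ/120`.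
  have hQ : Tendsto (fun r => 2 * (unstableFst r / Real.exp (unstableRate * r)) +
      2 * unstableFst r * (unstableFst r / Real.exp (unstableRate * r)) -
      (1 / 2 + unstableFst r) * (unstableSnd r / Real.exp (unstableRate * r))) atBot
      (𝓝 (unstableRate / 120)) := by
    have := (((hX.const_mul 2).add ((hx.const_mul 2).mul hX)).sub (hH.mul hY))
    convert this using 2
    ring
  filter_upwards [hX.eventually_lt_const (by norm_num : -(1 / 120 : ℝ) < 0),
    hY.eventually_lt_const (by linarith : -((2 + unstableRate) / 60) < 0),
    hH.eventually_const_lt (by norm_num : (0 : ℝ) < 1 / 2),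
    hK.eventually_const_lt (by norm_num : (0 : ℝ) < 1 / 4),
    hQ.eventually_const_lt (by positivity : (0 : ℝ) < unstableRate / 120)] with r h1 h2 h3 h4 h5
  have he := Real.exp_pos (unstableRate * r)
  have h1' : unstableFst r < 0 := by simpa using (div_lt_iff₀ he).1 h1
  have h2' : unstableSnd r < 0 := by simpa using (div_lt_iff₀ he).1 h2
  refine ⟨h3, by simp only; linarith, h2', h4, ?_⟩
  have h6 := mul_pos h5 he
  simp only
  have h7 : (2 * (unstableFst r / Real.exp (unstableRate * r)) +
      2 * unstableFst r * (unstableFst r / Real.exp (unstableRate * r)) -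
      (1 / 2 + unstableFst r) * (unstableSnd r / Real.exp (unstableRate * r))) *
        Real.exp (unstableRate * r) =
      2 * (1 / 2 + unstableFst r) ^ 2 - (1 / 2 + unstableFst r) * unstableSnd r - 1 / 2 := by
    field_simp
    ring
  rwa [h7] at h6

/-- The trajectory emanating from the saddle point `(1/2, 0)`. -/
theorem exists_unstable_trajectory :
    ∃ γ : ℝ → ℝ × ℝ, (∀ t, HasDerivAt γ (solitonField (γ t)) t) ∧ (∀ t, IsPinched (γ t)) ∧
      ∃ a, ∀ t ≤ a, |(γ t).1 - 1 / 2| ≤ Real.exp (unstableRate * t) ∧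
        |(γ t).2| ≤ Real.exp (unstableRate * t) := by
  have hrate := unstableRate_bounds
  have hX := (tendsto_unstableFst_div.abs).eventually_lt_const (u := 1) (by norm_num)
  have hY := (tendsto_unstableSnd_div.abs).eventually_lt_const (u := 1) (by
    rw [abs_neg, abs_of_pos (by linarith)]
    linarith)
  obtain ⟨r₁, hr₁⟩ := eventually_atBot.1
    ((eventually_isPinched_unstable.and (hX.and hY)).and (eventually_lt_atBot 0))
  have hneg : r₁ < 0 := (hr₁ r₁ le_rfl).2
  -- The system is autonomous, so time is translated to make the whole half-line `t ≤ 0` lie in the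
  -- pinched range of the series.
  set γ₀ : ℝ → ℝ × ℝ := fun t => (1 / 2 + unstableFst (t + r₁), unstableSnd (t + r₁)) with hγ₀
  have hsol : ∀ t ≤ 0, HasDerivAt γ₀ (solitonField (γ₀ t)) t := by
    intro t ht
    have h0 : t + r₁ < 0 := by linarith
    have h1 := ((hasDerivAt_unstableFst h0).comp_add_const t r₁).const_add (1 / 2)
    have h2 := (hasDerivAt_unstableSnd h0).comp_add_const t r₁
    refine (h1.prodMk h2).congr_deriv ?_
    simp only [solitonField, hγ₀, Prod.mk.injEq]
    constructor <;> ring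
  have hpin0 : IsPinched (γ₀ 0) := by
    have := (hr₁ (0 + r₁) (by simp)).1.1
    exact this
  obtain ⟨γ, hγ, heq⟩ := exists_global_extension contDiff_solitonField hsol
    fun T hT => exists_forward_solution hpin0 hT
  refine ⟨γ, hγ, fun t => ?_, 0, fun t ht => ?_⟩
  · rcases le_total t 0 with ht | ht
    · rw [heq t ht]
      exact (hr₁ (t + r₁) (by linarith)).1.1
    · exact isPinched_of_hasDerivAt (fun s _ => hγ s) (by rwa [heq 0 le_rfl]) t ⟨ht, le_rfl⟩
  · rw [heq t ht]
    obtain ⟨h1, h2⟩ := (hr₁ (t + r₁) (by linarith)).1.2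
    have hexp : Real.exp (unstableRate * (t + r₁)) ≤ Real.exp (unstableRate * t) := by
      apply Real.exp_le_exp.2
      nlinarith
    have he := Real.exp_pos (unstableRate * (t + r₁))
    rw [abs_div, abs_of_pos he, div_lt_one he] at h1 h2
    simp only [hγ₀, add_sub_cancel_left]
    exact ⟨h1.le.trans hexp, h2.le.trans hexp⟩

/-- Regularity bootstraps: if `γ` is `Cⁿ`, then so is `γ' = V ∘ γ`. -/
theorem contDiff_of_hasDerivAt_comp {E : Type*} [NormedAddCommGroup E] [NormedSpace ℝ E]
    {V : E → E} (hV : ContDiff ℝ ∞ V) {γ : ℝ → E} (hγ : ∀ t, HasDerivAt γ (V (γ t)) t) :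
    ContDiff ℝ ∞ γ := by
  refine contDiff_infty.2 fun n => ?_
  induction n with
  | zero => exact contDiff_zero.2 (continuous_iff_continuousAt.2 fun t => (hγ t).continuousAt)
  | succ n ih =>
    have hd : deriv γ = fun t => V (γ t) := funext fun t => (hγ t).deriv
    rw [Nat.cast_succ]
    refine contDiff_succ_iff_deriv.2 ⟨fun t => (hγ t).differentiableAt, by simp, ?_⟩
    rw [hd]
    exact (contDiff_infty.1 hV n).comp ih

theorem exists_smooth_primitive {u : ℝ → ℝ} (hu : ContDiff ℝ ∞ u) :
    ∃ U : ℝ → ℝ, ContDiff ℝ ∞ U ∧ deriv U = u := by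
  have h : ∀ r, HasDerivAt (fun r => ∫ t in (0 : ℝ)..r, u t) (u r) r := fun r =>
    (hu.continuous.integral_hasStrictDerivAt 0 r).hasDerivAt
  have hd : deriv (fun r => ∫ t in (0 : ℝ)..r, u t) = u := funext fun r => (h r).deriv
  exact ⟨_, contDiff_infty_iff_deriv.2 ⟨fun r => (h r).differentiableAt, by rwa [hd]⟩, hd⟩

end Soliton

theorem exists_tendsto_atTop_of_deriv_le {u : ℝ → ℝ} {C : ℝ}
    (hu : ∀ t ∈ Set.Ioi (1 : ℝ), DifferentiableAt ℝ u t)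
    (hC : ∀ t ∈ Set.Ioi (1 : ℝ), |deriv u t| ≤ C / t ^ 2) :
    ∃ l, Tendsto u atTop (𝓝 l) := by
  refine ⟨_, MeasureTheory.tendsto_limUnder_of_hasDerivAt_of_integrableOn_Ioi
    (fun t ht => (hu t ht).hasDerivAt) ?_⟩
  have hint := (integrableOn_Ioi_rpow_of_lt (by norm_num : (-2 : ℝ) < -1) zero_lt_one).const_mul C
  refine hint.mono' (aestronglyMeasurable_deriv u _) ?_
  refine (MeasureTheory.ae_restrict_iff' measurableSet_Ioi).2 (Eventually.of_forall fun t ht => ?_)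
  have ht0 : (0 : ℝ) < t := lt_trans zero_lt_one ht
  rw [Real.norm_eq_abs, Real.rpow_neg ht0.le, ← div_eq_mul_inv]
  exact_mod_cast hC t ht

theorem exists_tendsto_atBot_of_deriv_le {u : ℝ → ℝ} {a k : ℝ} (hk : 0 < k)
    (hu : ∀ t ≤ a, DifferentiableAt ℝ u t)
    (hC : ∀ t ≤ a, |deriv u t| ≤ Real.exp (k * t)) :
    ∃ l, Tendsto u atBot (𝓝 l) := by
  refine ⟨_, MeasureTheory.tendsto_limUnder_of_hasDerivAt_of_integrableOn_Iic
    (a := a) (fun t ht => (hu t ht).hasDerivAt) ?_⟩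
  refine (integrableOn_exp_mul_Iic hk a).mono' (aestronglyMeasurable_deriv u _) ?_
  exact (MeasureTheory.ae_restrict_iff' measurableSet_Iic).2 (Eventually.of_forall hC)

end

/-! ### Asymptotics at the conical end. -/

noncomputable section

namespace Soliton

section Asymptotics

variable {H F : ℝ → ℝ}

/-- A bound for the decay of `H` along a pinched trajectory. -/
theorem exists_pinched_decay (hH : ∀ t, HasDerivAt H (H t * F t - 2 * H t ^ 2 + 1 / 2) t)
    (hF : ∀ t, HasDerivAt F (2 * H t * F t - 2 * H t ^ 2 + 1 / 2) t)
    (hpin : ∀ t, IsPinched (H t, F t)) :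
    ∃ c > 0, ∀ t, 0 < t → F t ≤ -(c * t) ∧ H t ≤ 1 / (2 * c * t) := by
  have hanti : Antitone H := antitone_of_hasDerivAt_nonpos hH fun t => by
    have := (hpin t).2.2.2.2
    simp only at this
    show _ ≤ (0 : ℝ)
    linarith
  have h0 := hpin 0
  have hc : 0 < 1 / 2 - 2 * H 0 ^ 2 := by nlinarith [h0.1, h0.2.1]
  -- Since `H` decreases and `2H² - HF - 1/2 > 0`, one has `F' ≤ 2H² - 1/2 ≤ -(1/2 - 2H(0)²)`.
  have hFlin : ∀ t, 0 < t → F t ≤ -((1 / 2 - 2 * H 0 ^ 2) * t) := by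
    intro t ht
    have hd : ∀ s, HasDerivAt (fun s => F s + (1 / 2 - 2 * H 0 ^ 2) * s)
        (2 * H s * F s - 2 * H s ^ 2 + 1 / 2 + (1 / 2 - 2 * H 0 ^ 2) * 1) s := fun s =>
      (hF s).add ((hasDerivAt_id s).const_mul _)
    have hmono : AntitoneOn (fun s => F s + (1 / 2 - 2 * H 0 ^ 2) * s) (Set.Icc 0 t) := by
      refine antitoneOn_of_hasDerivWithinAt_nonpos (convex_Icc 0 t)
        (fun s _ => (hd s).continuousAt.continuousWithinAt)
        (fun s _ => (hd s).hasDerivWithinAt) fun s hs => ?_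
      have hs' := interior_subset hs
      have h1 := hanti hs'.1
      obtain ⟨h2, -, -, -, h3⟩ := hpin s
      simp only at h2 h3
      have h4 : H s ^ 2 ≤ H 0 ^ 2 := by gcongr
      linarith
    have h1 := hmono ⟨le_rfl, ht.le⟩ ⟨ht.le, le_rfl⟩ ht.le
    have h2 := h0.2.2.1
    simp only [mul_zero, add_zero] at h1 h2
    linarith
  refine ⟨_, hc, fun t ht => ⟨hFlin t ht, ?_⟩⟩
  obtain ⟨h1, -, -, h3, -⟩ := hpin t
  simp only at h1 h3
  have h4 := hFlin t ht
  rw [le_div_iff₀ (by positivity)]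
  -- Pinching gives `-HF < 1/2`, so a linear lower bound for `-F` bounds `H` by a multiple of `1/t`.
  nlinarith [mul_le_mul_of_nonneg_left h4 h1.le, sq_nonneg (H t)]

/-- Everything follows from `H² - 1/2 < HF < 2H² - 1/2` and `H = O(1/t)`. The first gives `0 ≤ (F +
t/2)' ≤ 2H²`, which is integrable at infinity. -/
theorem pinched_asymptotics (hH : ∀ t, HasDerivAt H (H t * F t - 2 * H t ^ 2 + 1 / 2) t)
    (hF : ∀ t, HasDerivAt F (2 * H t * F t - 2 * H t ^ 2 + 1 / 2) t)
    (hpin : ∀ t, IsPinched (H t, F t)) :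
    Tendsto H atTop (𝓝 0) ∧ Tendsto (fun t => H t * F t) atTop (𝓝 (-(1 / 2))) ∧
      (∃ l, Tendsto (fun t => F t + t / 2) atTop (𝓝 l)) ∧
      ∃ C, ∀ t, 1 < t → |H t - t⁻¹| ≤ C / t ^ 2 := by
  obtain ⟨c, hc, hdecay⟩ := exists_pinched_decay hH hF hpin
  have hinv : Tendsto (fun t : ℝ => 1 / (2 * c * t)) atTop (𝓝 0) :=
    tendsto_const_nhds.div_atTop (tendsto_id.const_mul_atTop (by positivity))
  have hH0 : Tendsto H atTop (𝓝 0) := by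
    refine tendsto_of_tendsto_of_tendsto_of_le_of_le' tendsto_const_nhds hinv
      (Eventually.of_forall fun t => (hpin t).1.le) ?_
    filter_upwards [eventually_gt_atTop 0] with t ht
    exact (hdecay t ht).2
  have hHF : Tendsto (fun t => H t * F t) atTop (𝓝 (-(1 / 2))) := by
    have h2 : Tendsto (fun t => 2 * H t ^ 2 - 1 / 2) atTop (𝓝 (-(1 / 2))) := by
      have := ((hH0.pow 2).const_mul 2).sub_const (1 / 2)
      norm_num at this ⊢
      exact this
    refine tendsto_of_tendsto_of_tendsto_of_le_of_le tendsto_const_nhds h2 (fun t => ?_) fun t => ?_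
    · have := (hpin t).2.2.2.1
      simp only at this ⊢
      nlinarith [sq_nonneg (H t)]
    · have := (hpin t).2.2.2.2
      simp only at this ⊢
      linarith
  have hHsq : ∀ t, 0 < t → H t ^ 2 ≤ 1 / (4 * c ^ 2) / t ^ 2 := by
    intro t ht
    calc H t ^ 2 ≤ (1 / (2 * c * t)) ^ 2 := by
          have := (hpin t).1.le
          have h2 := (hdecay t ht).2
          simp only at this
          gcongr
      _ = 1 / (4 * c ^ 2) / t ^ 2 := by field_simp; norm_num
  have hd : ∀ t, HasDerivAt (fun t => F t + t / 2)
      (2 * H t * F t - 2 * H t ^ 2 + 1 / 2 + 1 / 2) t := fun t =>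
    (hF t).add ((hasDerivAt_id t).div_const 2)
  obtain ⟨l, hl⟩ : ∃ l, Tendsto (fun t => F t + t / 2) atTop (𝓝 l) := by
    refine exists_tendsto_atTop_of_deriv_le (C := 1 / (2 * c ^ 2))
      (fun t _ => (hd t).differentiableAt) fun t ht => ?_
    have ht0 : (0 : ℝ) < t := zero_lt_one.trans ht
    obtain ⟨h1, -, -, h3, h4⟩ := hpin t
    simp only at h1 h3 h4
    rw [(hd t).deriv, abs_of_nonneg (by linarith)]
    have h5 := hHsq t ht0
    calc 2 * H t * F t - 2 * H t ^ 2 + 1 / 2 + 1 / 2 ≤ 2 * H t ^ 2 := by linarith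
      _ ≤ 2 * (1 / (4 * c ^ 2) / t ^ 2) := by linarith
      _ = 1 / (2 * c ^ 2) / t ^ 2 := by field_simp; norm_num
  refine ⟨hH0, hHF, ⟨l, hl⟩, ?_⟩
  obtain ⟨M, hM⟩ : ∃ M, ∀ t, 1 < t → |F t + t / 2| ≤ M := by
    have hmono : Monotone fun t => F t + t / 2 := monotone_of_hasDerivAt_nonneg hd fun t => by
      have := (hpin t).2.2.2.1
      simp only at this ⊢
      show 0 ≤ _
      linarith
    refine ⟨max |F 1 + 1 / 2| |l|, fun t ht => ?_⟩
    exact abs_le_max_abs_abs (hmono ht.le) (hmono.ge_of_tendsto hl t)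
  refine ⟨(M + 2 * (1 / (4 * c ^ 2))) / c, fun t ht => ?_⟩
  have ht0 : (0 : ℝ) < t := zero_lt_one.trans ht
  obtain ⟨h1, -, h2, h3, h4⟩ := hpin t
  simp only at h1 h2 h3 h4
  have h5 := hHsq t ht0
  have h6 := (hdecay t ht0).1
  have hFt : 0 < -F t := by linarith
  have hct : 0 < c * t := by positivity
  have h7 := abs_le.1 (hM t ht)
  have hsq : H t ^ 2 * t ≤ 1 / (4 * c ^ 2) := by
    have : H t ^ 2 * t ^ 2 ≤ 1 / (4 * c ^ 2) := by
      rwa [le_div_iff₀ (by positivity)] at h5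
    exact (mul_le_mul_of_nonneg_left (by nlinarith : t ≤ t ^ 2) (sq_nonneg (H t))).trans this
  have hnum : |(H t - t⁻¹) * (-F t * t)| ≤ M + 2 * (1 / (4 * c ^ 2)) := by
    -- Here `|HF + 1/2| ≤ 2H² = O(1/t²)` and `F + t/2` is bounded, so the right side is bounded; the
    -- factor `-F t` grows at least like `c t²`.
    have e : (H t - t⁻¹) * (-F t * t) = (-(H t * F t) - 1 / 2) * t + (F t + t / 2) := by
      field_simp
      ring
    rw [e, abs_le]
    constructor
    · nlinarith
    · nlinarith [sq_nonneg (H t)]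
  have hpos : 0 < -F t * t := by positivity
  rw [abs_mul, abs_of_pos hpos] at hnum
  have hlow : c * t ^ 2 ≤ -F t * t := by nlinarith
  rw [div_div, le_div_iff₀ (by positivity)]
  calc |H t - t⁻¹| * (c * t ^ 2) ≤ |H t - t⁻¹| * (-F t * t) := by gcongr
    _ ≤ _ := hnum

end Asymptotics

end Soliton
end

/-! ### Growth comparisons and the saddle point. -/

noncomputable section

/-- An eventually bounded derivative allows at most linear growth. -/
theorem tendsto_div_sq_atTop_zero {u u' : ℝ → ℝ} {l : ℝ} (hu : ∀ t, HasDerivAt u (u' t) t)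
    (hl : Tendsto u' atTop (𝓝 l)) : Tendsto (fun t => u t / t ^ 2) atTop (𝓝 0) := by
  obtain ⟨R, hR⟩ := eventually_atTop.1 (hl.abs.eventually_le_const (lt_add_one |l|))
  have hlip : ∀ t ∈ Set.Ici R, |u t - u R| ≤ (|l| + 1) * |t - R| := fun t ht =>
    (convex_Ici R).norm_image_sub_le_of_norm_hasDerivWithin_le
      (fun s _ => (hu s).hasDerivWithinAt) (fun s hs => hR s hs) Set.self_mem_Ici ht
  have hinv : Tendsto (fun t : ℝ => t⁻¹) atTop (𝓝 0) := tendsto_inv_atTop_zero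
  have hbound : Tendsto (fun t : ℝ => |u R| * (t⁻¹ * t⁻¹) +
      (|l| + 1) * (t⁻¹ + |R| * (t⁻¹ * t⁻¹))) atTop (𝓝 0) := by
    simpa using ((hinv.mul hinv).const_mul |u R|).add
      ((hinv.add ((hinv.mul hinv).const_mul |R|)).const_mul (|l| + 1))
  refine squeeze_zero_norm' ?_ hbound
  filter_upwards [eventually_ge_atTop R, eventually_gt_atTop 0] with t ht ht0
  have h1 := hlip t ht
  have h2 : |u t| ≤ |u R| + |u t - u R| := by
    have := abs_add_le (u R) (u t - u R)
    rwa [add_sub_cancel] at this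
  have h3 : |t - R| ≤ t + |R| := by
    have := abs_sub t R
    rwa [abs_of_pos ht0] at this
  have h4 : |u t| ≤ |u R| + (|l| + 1) * (t + |R|) :=
    h2.trans (by gcongr; exact h1.trans (by gcongr))
  rw [Real.norm_eq_abs, abs_div, abs_of_pos (by positivity : 0 < t ^ 2),
    div_le_iff₀ (by positivity)]
  refine h4.trans_eq ?_
  field_simp

theorem tendsto_div_one_of_tendsto_sub {α : Type*} {l : Filter α} {u v : α → ℝ} {c : ℝ}
    (hsub : Tendsto (fun t => u t - v t) l (𝓝 c)) (hv : Tendsto (fun t => (v t)⁻¹) l (𝓝 0))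
    (hne : ∀ᶠ t in l, v t ≠ 0) : Tendsto (fun t => u t / v t) l (𝓝 1) := by
  have h := (hsub.mul hv).add_const 1
  rw [mul_zero, zero_add] at h
  refine h.congr' ?_
  filter_upwards [hne] with t ht
  field_simp
  ring

namespace Soliton

theorem hasFDerivAt_solitonField_saddle : HasFDerivAt solitonField
    ((((-2 : ℝ) • ContinuousLinearMap.fst ℝ ℝ ℝ + (1 / 2 : ℝ) • ContinuousLinearMap.snd ℝ ℝ ℝ).prod
      ((-2 : ℝ) • ContinuousLinearMap.fst ℝ ℝ ℝ + ContinuousLinearMap.snd ℝ ℝ ℝ)))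
    ((1 / 2, 0) : ℝ × ℝ) := by
  have h1 : HasFDerivAt (fun z : ℝ × ℝ => z.1) (ContinuousLinearMap.fst ℝ ℝ ℝ)
      ((1 / 2, 0) : ℝ × ℝ) := hasFDerivAt_fst
  have h2 : HasFDerivAt (fun z : ℝ × ℝ => z.2) (ContinuousLinearMap.snd ℝ ℝ ℝ)
      ((1 / 2, 0) : ℝ × ℝ) := hasFDerivAt_snd
  refine HasFDerivAt.prodMk ((((h1.mul h2).sub ((h1.pow 2).const_mul 2)).add_const
    (1 / 2)).congr_fderiv ?_) (((((h1.const_mul 2).mul h2).sub ((h1.pow 2).const_mul 2)).add_const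
    (1 / 2)).congr_fderiv ?_)
  · ext <;> simp
  · ext <;> simp

theorem isSaddlePoint_solitonField : IsSaddlePoint solitonField (1 / 2, 0) := by
  have hrate := unstableRate_bounds
  have hsq := unstableRate_sq
  -- The eigenvalues are the roots of `μ² + μ - 1`, and `(1, 2(2 + μ))` is an eigenvector for the
  -- root `μ`.
  refine ⟨by ext <;> norm_num [solitonField], hasFDerivAt_solitonField_saddle.differentiableAt,
    -1 - unstableRate, unstableRate, by linarith, by linarith, ?_, ?_⟩ <;>
  rw [hasFDerivAt_solitonField_saddle.fderiv]
  · refine Module.End.hasEigenvalue_of_hasEigenvector (x := ((1, 2 * (1 - unstableRate)) : ℝ × ℝ))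
      ⟨Module.End.mem_eigenspace_iff.2 ?_, fun h => by simpa using congrArg Prod.fst h⟩
    ext
    · simp
      ring
    · simp
      linarith
  · refine Module.End.hasEigenvalue_of_hasEigenvector (x := ((1, 2 * (2 + unstableRate)) : ℝ × ℝ))
      ⟨Module.End.mem_eigenspace_iff.2 ?_, fun h => by simpa using congrArg Prod.fst h⟩
    ext
    · simp
    · simp
      linarith

end Soliton

end

/-! ### Assembly of the soliton from the trajectory. -/

theorem mainTheorem5 :
    ∃ (h φ : ℝ → ℝ) (g : Soliton.LineTorusMetric) (f : Soliton.LineTorus → ℝ),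
      -- an expanding gradient Ricci soliton of warped form, with a radial potential
      ContDiff ℝ ∞ h ∧ ContDiff ℝ ∞ φ ∧
      Soliton.IsWarpedMetric g h ∧
      (∀ p : Soliton.LineTorus, f p = φ p.1) ∧
      Soliton.IsGradientRicciSoliton g f 1 ∧
      -- pinched sectional curvature
      (∀ p : Soliton.LineTorus, Soliton.SectionalCurvatureMem g p (Set.Ioo (-1 / 4) 0)) ∧
      -- the end `r → -∞`: the hyperbolic cusp soliton `dr² + e^{r + 2c} (dx² + dy²)`
      (Tendsto (fun r => h r / (r / 2)) atBot (𝓝 1) ∧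
        (∃ c : ℝ, Tendsto (fun r => h r - r / 2) atBot (𝓝 c)) ∧
        Tendsto (deriv h) atBot (𝓝 (1 / 2)) ∧
        Tendsto (deriv (deriv h)) atBot (𝓝 0) ∧
        (∃ c : ℝ, Tendsto φ atBot (𝓝 c)) ∧
        Tendsto (deriv φ) atBot (𝓝 0) ∧
        Tendsto (deriv (deriv φ)) atBot (𝓝 0) ∧
        Soliton.SectionalCurvatureTendsto g atBot (-1 / 4)) ∧
      -- the end `r → +∞`: the cone `dr² + e^{2c} r² (dx² + dy²)`, locally the Gaussian soliton
      (Tendsto (fun r => h r / Real.log r) atTop (𝓝 1) ∧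
        (∃ c : ℝ, Tendsto (fun r => h r - Real.log r) atTop (𝓝 c)) ∧
        Tendsto (fun r => r * deriv h r) atTop (𝓝 1) ∧
        Tendsto (deriv (deriv h)) atTop (𝓝 0) ∧
        Tendsto (fun r => φ r / (-(r ^ 2) / 4)) atTop (𝓝 1) ∧
        Tendsto (fun r => deriv φ r / (-r / 2)) atTop (𝓝 1) ∧
        Tendsto (deriv (deriv φ)) atTop (𝓝 (-1 / 2)) ∧
        Soliton.SectionalCurvatureTendsto g atTop 0) ∧
      -- `(h', f')` is a separatrix of the planar system, with vertical asymptote `H = 0`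
      Soliton.IsSeparatrixFrom Soliton.solitonField (1 / 2, 0)
        (fun r => (deriv h r, deriv φ r)) ∧
      Tendsto (deriv h) atTop (𝓝 0) ∧
      Tendsto (deriv φ) atTop atBot := by
  obtain ⟨γ, hγ, hpin, a, ha⟩ := Soliton.exists_unstable_trajectory
  have hγsmooth := Soliton.contDiff_of_hasDerivAt_comp Soliton.contDiff_solitonField hγ
  obtain ⟨h, hh, hdh⟩ := Soliton.exists_smooth_primitive hγsmooth.fst
  obtain ⟨φ, hφ, hdφ⟩ := Soliton.exists_smooth_primitive hγsmooth.snd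
  have hγeq : ∀ r, γ r = (deriv h r, deriv φ r) := fun r => by rw [hdh, hdφ]
  have hd1 : ∀ r, HasDerivAt h (deriv h r) r := fun r =>
    (hh.differentiable (by simp) r).hasDerivAt
  have hd2 : ∀ r, HasDerivAt φ (deriv φ r) r := fun r =>
    (hφ.differentiable (by simp) r).hasDerivAt
  have hH : ∀ r, HasDerivAt (deriv h)
      (deriv h r * deriv φ r - 2 * deriv h r ^ 2 + 1 / 2) r := fun r => by
    rw [hdh, hdφ]
    exact Soliton.hasDerivAt_fst (hγ r)
  have hF : ∀ r, HasDerivAt (deriv φ)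
      (2 * deriv h r * deriv φ r - 2 * deriv h r ^ 2 + 1 / 2) r := fun r => by
    rw [hdh, hdφ]
    exact Soliton.hasDerivAt_snd (hγ r)
  have hP : ∀ r, Soliton.IsPinched (deriv h r, deriv φ r) := fun r => hγeq r ▸ hpin r
  have hH2 : deriv (deriv h) = fun r => deriv h r * deriv φ r - 2 * deriv h r ^ 2 + 1 / 2 :=
    funext fun r => (hH r).deriv
  have hF2 : deriv (deriv φ) = fun r => 2 * deriv h r * deriv φ r - 2 * deriv h r ^ 2 + 1 / 2 :=
    funext fun r => (hF r).deriv
  have hg := Soliton.isWarpedMetric_warpedMetric h hh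
  -- the cusp end
  have hbd1 : ∀ r ≤ a, |deriv h r - 1 / 2| ≤ Real.exp (Soliton.unstableRate * r) := fun r hr => by
    rw [hdh]
    exact (ha r hr).1
  have hbd2 : ∀ r ≤ a, |deriv φ r| ≤ Real.exp (Soliton.unstableRate * r) := fun r hr => by
    rw [hdφ]
    exact (ha r hr).2
  have hHbot : Tendsto (deriv h) atBot (𝓝 (1 / 2)) :=
    tendsto_sub_nhds_zero_iff.1 (squeeze_zero_norm'
      ((eventually_le_atBot a).mono hbd1) Soliton.tendsto_exp_rate_atBot_zero)
  have hFbot : Tendsto (deriv φ) atBot (𝓝 0) :=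
    squeeze_zero_norm' ((eventually_le_atBot a).mono hbd2) Soliton.tendsto_exp_rate_atBot_zero
  have hH2bot : Tendsto (deriv (deriv h)) atBot (𝓝 0) := by
    rw [hH2]
    have := ((hHbot.mul hFbot).sub ((hHbot.pow 2).const_mul 2)).add_const (1 / 2)
    norm_num at this ⊢
    exact this
  have hF2bot : Tendsto (deriv (deriv φ)) atBot (𝓝 0) := by
    rw [hF2]
    have := (((hHbot.const_mul 2).mul hFbot).sub ((hHbot.pow 2).const_mul 2)).add_const (1 / 2)
    norm_num at this ⊢
    exact this
  obtain ⟨c₁, hc₁⟩ : ∃ c, Tendsto (fun r => h r - r / 2) atBot (𝓝 c) := by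
    have hd : ∀ r, HasDerivAt (fun r => h r - r / 2) (deriv h r - 1 / 2) r := fun r =>
      (hd1 r).sub ((hasDerivAt_id r).div_const 2)
    refine exists_tendsto_atBot_of_deriv_le (a := a) Soliton.unstableRate_pos
      (fun r _ => (hd r).differentiableAt) fun r hr => ?_
    rw [(hd r).deriv]
    exact hbd1 r hr
  have hhbot : Tendsto (fun r => h r / (r / 2)) atBot (𝓝 1) :=
    tendsto_div_one_of_tendsto_sub hc₁
      (tendsto_inv_atBot_zero.comp (tendsto_id.atBot_div_const two_pos))
      ((eventually_lt_atBot 0).mono fun r hr => by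
        have : r / 2 < 0 := by linarith
        exact this.ne)
  have hφbot : ∃ c, Tendsto φ atBot (𝓝 c) :=
    exists_tendsto_atBot_of_deriv_le (a := a) Soliton.unstableRate_pos
      (fun r _ => (hd2 r).differentiableAt) hbd2
  -- the conical end
  obtain ⟨hHtop, hHFtop, ⟨l, hl⟩, C, hC⟩ := Soliton.pinched_asymptotics hH hF hP
  obtain ⟨c₂, hc₂⟩ : ∃ c, Tendsto (fun r => h r - Real.log r) atTop (𝓝 c) := by
    have hd : ∀ r ∈ Set.Ioi (1 : ℝ),
        HasDerivAt (fun r => h r - Real.log r) (deriv h r - r⁻¹) r := fun r hr =>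
      (hd1 r).sub (Real.hasDerivAt_log (zero_lt_one.trans hr).ne')
    refine exists_tendsto_atTop_of_deriv_le (C := C)
      (fun r hr => (hd r hr).differentiableAt) fun r hr => ?_
    rw [(hd r hr).deriv]
    exact hC r hr
  have hhtop : Tendsto (fun r => h r / Real.log r) atTop (𝓝 1) :=
    tendsto_div_one_of_tendsto_sub hc₂ (tendsto_inv_atTop_zero.comp Real.tendsto_log_atTop)
      ((eventually_gt_atTop 1).mono fun r hr => (Real.log_pos hr).ne')
  have hFtop1 : Tendsto (fun r => deriv φ r / (-r / 2)) atTop (𝓝 1) := by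
    refine tendsto_div_one_of_tendsto_sub (c := l) (hl.congr fun r => by ring) ?_
      ((eventually_gt_atTop 0).mono fun r hr => by
        have : -r / 2 < 0 := by linarith
        exact this.ne)
    exact tendsto_inv_atBot_zero.comp (tendsto_neg_atTop_atBot.atBot_div_const two_pos)
  have hrH : Tendsto (fun r => r * deriv h r) atTop (𝓝 1) := by
    -- Writes `rH = -2 (HF) · (-r/2)/F`, where `HF → -1/2` and `F ~ -r/2`.
    have := (hHFtop.const_mul (-2)).mul (hFtop1.inv₀ one_ne_zero)
    norm_num at this
    refine this.congr' ?_
    filter_upwards [eventually_gt_atTop 0] with r hr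
    have hne := (hP r).2.2.1.ne
    simp only at hne
    field_simp
  have hH2top : Tendsto (deriv (deriv h)) atTop (𝓝 0) := by
    rw [hH2]
    have := (hHFtop.sub ((hHtop.pow 2).const_mul 2)).add_const (1 / 2)
    norm_num at this ⊢
    exact this
  have hF2top : Tendsto (deriv (deriv φ)) atTop (𝓝 (-1 / 2)) := by
    rw [hF2]
    have := ((hHFtop.const_mul 2).sub ((hHtop.pow 2).const_mul 2)).add_const (1 / 2)
    norm_num at this ⊢
    simpa only [mul_assoc] using this
  have hφtop : Tendsto (fun r => φ r / (-(r ^ 2) / 4)) atTop (𝓝 1) := by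
    -- The derivative of `φ + r²/4` converges, so this function is negligible against `r²`.
    have hd : ∀ r, HasDerivAt (fun r => φ r + r ^ 2 / 4) (deriv φ r + r / 2) r := fun r => by
      have := (hd2 r).add (((hasDerivAt_id r).pow 2).div_const 4)
      refine this.congr_deriv ?_
      simp
      ring
    have := ((tendsto_div_sq_atTop_zero hd hl).const_mul (-4)).add_const 1
    norm_num at this
    refine this.congr' ?_
    filter_upwards [eventually_gt_atTop 0] with r hr
    field_simp
    ring
  have hFtop : Tendsto (deriv φ) atTop atBot := by
    have := hl.add_atBot (tendsto_neg_atTop_atBot.atBot_div_const (two_pos (α := ℝ)))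
    refine this.congr fun r => ?_
    ring
  refine ⟨h, φ, Soliton.warpedMetric h hh, fun p => φ p.1, hh, hφ, hg, fun p => rfl,
    Soliton.isGradientRicciSoliton_of_isWarpedMetric hh hφ hg (fun r => (hH r).deriv)
      fun r => (hF r).deriv, fun p => ?_,
    ⟨hhbot, ⟨c₁, hc₁⟩, hHbot, hH2bot, hφbot, hFbot, hF2bot, ?_⟩,
    ⟨hhtop, ⟨c₂, hc₂⟩, hrH, hH2top, hφtop, hFtop1, hF2top, ?_⟩,
    ⟨Soliton.isSaddlePoint_solitonField, fun r => ?_, ⟨0, ?_⟩, ?_⟩, hHtop, hFtop⟩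
  -- Pinching says `0 < h'' + h'² < h'² < 1/4`, which bounds both principal curvatures.
  · obtain ⟨h1, h2, -, h3, h4⟩ := hP p.1
    simp only at h1 h2 h3 h4
    have h5 : deriv h p.1 ^ 2 < 1 / 4 := by nlinarith
    refine Soliton.sectionalCurvatureMem_of_isWarpedMetric hh hg (convex_Ioo _ _) p ?_ ?_
    · rw [hH2]
      constructor <;> linarith
    · have : 0 < deriv h p.1 ^ 2 := by positivity
      constructor <;> linarith
  · have hsq := hHbot.pow 2
    refine Soliton.sectionalCurvatureTendsto_of_isWarpedMetric hh hg ?_ ?_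
    · have := (hH2bot.add hsq).neg
      norm_num at this ⊢
      exact this
    · have := hsq.neg
      norm_num at this ⊢
      exact this
  · have hsq := hHtop.pow 2
    refine Soliton.sectionalCurvatureTendsto_of_isWarpedMetric hh hg ?_ ?_
    · simpa using (hH2top.add hsq).neg
    · simpa using hsq.neg
  · exact (hH r).prodMk (hF r)
  · exact fun h0 => (hP 0).2.1.ne (congrArg Prod.fst h0)
  · exact hHbot.prodMk_nhds hFbot
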